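/- Let $p$ be a prime. Throughout, products and conjugation are written in right-handed notation, $x^g=\Pi(g^{-1},x,g)$. **Terminology.** For a finite group $G$ let $O_p(G)$ and $O_{p'}(G)$ be the largest normal $p$-subgroup and the largest normal subgroup of order prime to $p$. $G$ is *of characteristic $p$* if $C_G(O_p(G))\le O_p(G)$, and *almost of characteristic $p$* if $G/O_{p'}(G)$ is of characteristic $p$. A *partial group* is a non-empty set $\mathcal L$ with a set $\mathbf D$ of words in $\mathcal L$, a product $\Pi:\mathbf D\to\mathcal L$ and an involutory bijection $f\mapsto f^{-1}$ of $\mathcal L$ such that: all words of length one lie in $\mathbf D$, and $u\circ v\in\mathbf D$ implies $u,v\in\mathbf D$; $\Pi(f)=f$ for $f\in\mathcal L$; if $u\circ v\circ w\in\mathbf D$ then $u\circ(\Pi(v))\circ w\in\mathbf D$ and the two words have the same product; if $w=(f_1,\dots,f_n)\in\mathbf D$ and $w^{-1}=(f_n^{-1},\dots,f_1^{-1})$, then $w^{-1}\circ w\in\mathbf D$ and $\Pi(w^{-1}\circ w)=\mathbf 1:=\Pi(\emptyset)$. For $g\in\mathcal L$ let $\mathbf D(g)$ be the set of $x$ with $(g^{-1},x,g)\in\mathbf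 D$; for $X\subseteq\mathbf D(g)$ let $X^g=\{x^g: x\in X\}$, and let $N_{\mathcal L}(X)$ be the set of $g$ with $X\subseteq\mathbf D(g)$ and $X^g=X$. A *partial subgroup* is a subset closed under inversion and under all products of words in $\mathbf D$ with entries in it; it is a *subgroup* (and hence a group) if all words in it lie in $\mathbf D$, and a *$p$-subgroup* if moreover its order is a power of $p$. A partial subgroup $\mathcal N$ is *partial normal* if $n^f\in\mathcal N$ for all $f\in\mathcal L$ and $n\in\mathcal N\cap\mathbf D(f)$. A *locality* is a triple $(\mathcal L,\Delta,S)$ where $\mathcal L$ is a finite partial group, $S$ is a $p$-subgroup of $\mathcal L$, maximal among the $p$-subgroups, and $\Delta$ is a non-empty set of subgroups of $S$ such that: a word $(f_1,\dots,f_n)$ lies in $\mathbf D$ if and only if there are $P_0,\dots,P_n\in\Delta$ with $P_{i-1}\subseteq\mathbf D(f_i)$ and $P_{i-1}^{f_i}=P_i$ for $1\le i\le n$; if $P\in\Delta$, $g\in\mathcal L$, $P\subseteq\mathbf D(g)$ and $P^g\subseteq S$, then $P^g\in\Delta$; and every subgroup of $S$ containing an element of $\Delta$ lies in $\Delta$.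 Then $N_{\mathcal L}(P)$ is a finite group for each $P\in\Delta$; the locality is *of objective characteristic $p$* if all the groups $N_{\mathcal L}(P)$, $P\in\Delta$, are of characteristic $p$. Its fusion system $\mathcal F_S(\mathcal L)$ is the smallest fusion system over $S$ containing all conjugation maps $P\to Q$, $x\mapsto x^g$ ($g\in\mathcal L$) between subgroups $P,Q$ of $S$. For a partial normal subgroup $\mathcal N$ of a locality, $\mathcal L/\mathcal N$ is the set of right cosets $\mathcal Nf=\{\Pi(n,f): n\in\mathcal N,(n,f)\in\mathbf D\}$ that are maximal under inclusion. Each $g\in\mathcal L$ lies in exactly one of them, denoted $g\rho$; $\mathcal L/\mathcal N$ is the partial group whose domain is the set of images $(f_1\rho,\dots,f_n\rho)$ of the words $(f_1,\dots,f_n)\in\mathbf D$, with product $(f_1\rho,\dots,f_n\rho)\mapsto\Pi(f_1,\dots,f_n)\rho$; and $\rho:\mathcal L\to\mathcal L/\mathcal N$ is the canonical projection. **Proposition.** Let $(\mathcal L,\Delta,S)$ be a locality such that $N_{\mathcal L}(P)$ is almost of characteristic $p$ for every $P\in\Delta$. Set $\Theta(P)=O_{p'}(N_{\mathcal L}(P))$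 for $P\in\Delta$ and $\Theta=\bigcup_{P\in\Delta}\Theta(P)$. Then $\Theta$ is a partial normal subgroup of $\mathcal L$ with $\Theta\cap S=\{\mathbf 1\}$. The quotient partial group $\mathcal L/\Theta$ is well defined, and the canonical projection $\rho:\mathcal L\to\mathcal L/\Theta$ restricts to a group isomorphism $S\to S\rho$. Moreover: (a) $(\mathcal L/\Theta,\{P\rho: P\in\Delta\},S\rho)$ is a locality of objective characteristic $p$. (b) The isomorphism $\rho|_S:S\to S\rho$ induces an isomorphism of fusion systems from $\mathcal F_S(\mathcal L)$ to $\mathcal F_{S\rho}(\mathcal L/\Theta)$; that is, upon identifying $S$ with $S\rho$, $\mathcal F_S(\mathcal L/\Theta)=\mathcal F_S(\mathcal L)$. (c) For every $P\in\Delta$, $\rho$ restricts to a group homomorphism $N_{\mathcal L}(P)\to N_{\mathcal L/\Theta}(P\rho)$ with kernel $\Theta(P)$, which induces an isomorphism $N_{\mathcal L}(P)/\Theta(P)\cong N_{\mathcal L/\Theta}(P\rho)$. -/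

import Mathlib

universe u v

/-! ### Finite groups of characteristic `p` -/

/-- `O_p(G)`, the largest normal `p`-subgroup, as the join of all normal `p`-subgroups. -/
def Op (p : ℕ) (G : Type u) [Group G] : Subgroup G :=
  sSup {K : Subgroup G | K.Normal ∧ IsPGroup p K}

/-- `O_{p'}(G)`, the largest normal subgroup of order prime to `p` (for `G` finite),
as the join of all normal subgroups of order prime to `p`. -/
def OpPrime (p : ℕ) (G : Type u) [Group G] : Subgroup G :=
  sSup {K : Subgroup G | K.Normal ∧ (Nat.card K).Coprime p}

instance OpPrime.normal (p : ℕ) (G : Type u) [Group G] : (OpPrime p G).Normal :=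
  Subgroup.sSup_normal _ fun _ hK => hK.1

/-- `G` is of characteristic `p`: `C_G(O_p(G)) ≤ O_p(G)`. -/
def IsCharP (p : ℕ) (G : Type u) [Group G] : Prop :=
  Subgroup.centralizer (Op p G : Set G) ≤ Op p G

/-- `G` is almost of characteristic `p`: `G / O_{p'}(G)` is of characteristic `p`. -/
def IsAlmostCharP (p : ℕ) (G : Type u) [Group G] : Prop :=
  IsCharP p (G ⧸ OpPrime p G)

/-! ### Fusion systems -/

/-- A fusion system over the group `S`: a category on the subgroups of `S` whose morphisms are
injective homomorphisms, which contains all maps induced by conjugation in `S`, and in which each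
morphism is an isomorphism of the category followed by an inclusion. -/
structure FusionSystem (S : Type u) [Group S] where
  Hom : ∀ P Q : Subgroup S, Set (P →* Q)
  injective : ∀ {P Q : Subgroup S} {φ : P →* Q}, φ ∈ Hom P Q → Function.Injective φ
  conj_mem : ∀ {P Q : Subgroup S} (s : S) (φ : P →* Q),
    (∀ x : P, (φ x : S) = s⁻¹ * x * s) → φ ∈ Hom P Q
  comp_mem : ∀ {P Q R : Subgroup S} {φ : P →* Q} {ψ : Q →* R},
    φ ∈ Hom P Q → ψ ∈ Hom Q R → ψ.comp φ ∈ Hom P R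
  factor : ∀ {P Q : Subgroup S} {φ : P →* Q}, φ ∈ Hom P Q →
    ∀ (R : Subgroup S) (e : P ≃* R), (∀ x : P, (e x : S) = φ x) →
      e.toMonoidHom ∈ Hom P R ∧ e.symm.toMonoidHom ∈ Hom R P

namespace FusionSystem

variable {S : Type u} [Group S] {S' : Type v} [Group S']

/-- The intersection of a family of fusion systems (for the empty family: the fusion system
of all injective homomorphisms). -/
instance : InfSet (FusionSystem S) where
  sInf 𝒜 :=
    { Hom := fun P Q => {φ | Function.Injective φ ∧ ∀ F ∈ 𝒜, φ ∈ F.Hom P Q}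
      injective := fun h => h.1
      conj_mem := fun {P Q} s φ h => ⟨fun x y hxy => by
          have h1 : s⁻¹ * (x : S) * s = s⁻¹ * (y : S) * s := by rw [← h x, ← h y, hxy]
          exact Subtype.ext (mul_left_cancel (mul_right_cancel h1)),
        fun F _ => F.conj_mem s φ h⟩
      comp_mem := fun h h' =>
        ⟨h'.1.comp h.1, fun F hF => F.comp_mem (h.2 F hF) (h'.2 F hF)⟩
      factor := fun h R e he =>
        ⟨⟨e.injective, fun F hF => (F.factor (h.2 F hF) R e he).1⟩,
          ⟨e.symm.injective, fun F hF => (F.factor (h.2 F hF) R e he).2⟩⟩ }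

/-- `α : S → S'` induces a morphism from `F` to `F'`: for every `φ ∈ Hom_F(P, Q)` there is
`ψ ∈ Hom_{F'}(Pα, Qα)` with `ψ (α x) = α (φ x)` for `x ∈ P`. -/
def InducesMorphism (F : FusionSystem S) (F' : FusionSystem S') (α : S →* S') : Prop :=
  ∀ (P Q : Subgroup S), ∀ φ ∈ F.Hom P Q, ∃ ψ ∈ F'.Hom (P.map α) (Q.map α),
    ∀ x : P, (ψ ⟨α x, Subgroup.mem_map_of_mem α x.2⟩ : S') = α (φ x)

/-- `α : S → S'` induces an epimorphism from `F` to `F'`. -/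
def InducesEpi (F : FusionSystem S) (F' : FusionSystem S') (α : S →* S') : Prop :=
  F.InducesMorphism F' α ∧ Function.Surjective α ∧
    ∀ (P Q : Subgroup S), α.ker ≤ P ⊓ Q → ∀ ψ ∈ F'.Hom (P.map α) (Q.map α),
      ∃ φ ∈ F.Hom P Q, ∀ x : P, (ψ ⟨α x, Subgroup.mem_map_of_mem α x.2⟩ : S') = α (φ x)

/-- `α : S → S'` induces an isomorphism from `F` to `F'`. -/
def InducesIso (F : FusionSystem S) (F' : FusionSystem S') (α : S →* S') : Prop :=
  F.InducesEpi F' α ∧ Function.Injective α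

end FusionSystem

/-! ### Partial groups -/

/-- A partial group with underlying set `L`: a product `prod` defined on the words in `D`, and
an involutory inversion. (Values of `prod` outside `D` are meaningless and never used.) -/
structure PartialGroup (L : Type u) where
  D : Set (List L)
  prod : List L → L
  inv : L → L
  inv_inv : ∀ f, inv (inv f) = f
  single_mem : ∀ f, [f] ∈ D
  mem_of_append : ∀ a b, a ++ b ∈ D → a ∈ D ∧ b ∈ D
  prod_single : ∀ f, prod [f] = f
  collapse_mem : ∀ a b c, a ++ b ++ c ∈ D → a ++ [prod b] ++ c ∈ D
  prod_collapse : ∀ a b c, a ++ b ++ c ∈ D → prod (a ++ b ++ c) = prod (a ++ [prod b] ++ c)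
  inv_append_mem : ∀ w ∈ D, (w.map inv).reverse ++ w ∈ D
  prod_inv_append : ∀ w ∈ D, prod ((w.map inv).reverse ++ w) = prod []

namespace PartialGroup

variable {L : Type u} (𝓛 : PartialGroup L)

/-- The identity element, the product of the empty word. -/
def one : L := 𝓛.prod []

/-- `D(g)`, the set of all `x` for which `x^g` is defined. -/
def conjDom (g : L) : Set L := {x | [𝓛.inv g, x, g] ∈ 𝓛.D}

/-- `x^g`, meaningful for `x ∈ D(g)`. -/
def conj (x g : L) : L := 𝓛.prod [𝓛.inv g, x, g]

/-- `X^g`, meaningful for `X ⊆ D(g)`. -/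
def conjSet (X : Set L) (g : L) : Set L := (fun x => 𝓛.conj x g) '' X

/-- `N_L(X)`. -/
def normalizer (X : Set L) : Set L := {g | X ⊆ 𝓛.conjDom g ∧ 𝓛.conjSet X g = X}

/-- `H` is a partial subgroup of `L`. -/
def IsPartialSubgroup (H : Set L) : Prop :=
  (∀ f ∈ H, 𝓛.inv f ∈ H) ∧ ∀ w ∈ 𝓛.D, (∀ f ∈ w, f ∈ H) → 𝓛.prod w ∈ H

/-- `N` is a partial normal subgroup of `L`. -/
def IsPartialNormal (N : Set L) : Prop :=
  𝓛.IsPartialSubgroup N ∧ ∀ f : L, ∀ n ∈ N, n ∈ 𝓛.conjDom f → 𝓛.conj n f ∈ N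

/-- `H` is a subgroup of `L`: a partial subgroup on which all products are defined. -/
def IsSubgroup (H : Set L) : Prop :=
  𝓛.IsPartialSubgroup H ∧ ∀ w : List L, (∀ f ∈ w, f ∈ H) → w ∈ 𝓛.D

variable {𝓛}

/-- The type of elements of a subgroup of a partial group; it carries a group structure. -/
def IsSubgroup.Elems {H : Set L} (_ : 𝓛.IsSubgroup H) : Type u := H

/-- The element of `L` underlying an element of a subgroup. -/
def IsSubgroup.Elems.val {H : Set L} {h : 𝓛.IsSubgroup H} (x : h.Elems) : L := Subtype.val x

theorem IsSubgroup.Elems.mem {H : Set L} {h : 𝓛.IsSubgroup H} (x : h.Elems) : x.val ∈ H :=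
  Subtype.property x

/-- An element of the set `H`, seen in the group `H`. -/
def IsSubgroup.mk {H : Set L} (h : 𝓛.IsSubgroup H) (x : L) (hx : x ∈ H) : h.Elems := ⟨x, hx⟩

/-- The group structure on a subgroup of a partial group. -/
instance IsSubgroup.instGroup {H : Set L} (h : 𝓛.IsSubgroup H) : Group h.Elems where
  mul x y := h.mk (𝓛.prod [x.val, y.val]) <| by
    have hw : ∀ f ∈ [x.val, y.val], f ∈ H := by simp [x.mem, y.mem]
    exact h.1.2 _ (h.2 _ hw) hw
  one := h.mk (𝓛.prod []) <| h.1.2 _ (h.2 _ (by simp)) (by simp)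
  inv x := h.mk (𝓛.inv x.val) <| h.1.1 _ x.mem
  mul_assoc x y z := Subtype.ext <| by
    have hw : [x.val, y.val, z.val] ∈ 𝓛.D := h.2 _ (by simp [x.mem, y.mem, z.mem])
    exact (𝓛.prod_collapse [] [x.val, y.val] [z.val] hw).symm.trans
      (𝓛.prod_collapse [x.val] [y.val, z.val] [] hw)
  one_mul x := Subtype.ext <|
    (𝓛.prod_collapse [] [] [x.val] (𝓛.single_mem _)).symm.trans (𝓛.prod_single _)
  mul_one x := Subtype.ext <|
    (𝓛.prod_collapse [x.val] [] [] (𝓛.single_mem _)).symm.trans (𝓛.prod_single _)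
  inv_mul_cancel x := Subtype.ext <| 𝓛.prod_inv_append [x.val] (𝓛.single_mem _)

variable (𝓛)

/-- `H` is a `p`-subgroup of `L`: a subgroup of finite order a power of `p`. -/
def IsPSubgroup (p : ℕ) (H : Set L) : Prop :=
  ∃ h : 𝓛.IsSubgroup H, Finite h.Elems ∧ IsPGroup p h.Elems

/-! ### Localities -/

/-- `(L, Δ, S)` is a locality (for the prime `p`). -/
structure IsLocality (p : ℕ) (Δ : Set (Set L)) (S : Set L) : Prop where
  finite : Finite L
  isPSubgroup : 𝓛.IsPSubgroup p S
  nonempty : Δ.Nonempty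
  subgroup_of_mem : ∀ P ∈ Δ, 𝓛.IsSubgroup P ∧ P ⊆ S
  maximal : ∀ R : Set L, 𝓛.IsPSubgroup p R → S ⊆ R → R = S
  mem_D_iff : ∀ w : List L, w ∈ 𝓛.D ↔
    ∃ P : ℕ → Set L, (∀ i ≤ w.length, P i ∈ Δ) ∧
      ∀ (i : ℕ) (hi : i < w.length),
        P i ⊆ 𝓛.conjDom w[i] ∧ 𝓛.conjSet (P i) w[i] = P (i + 1)
  conj_mem : ∀ P ∈ Δ, ∀ g : L, P ⊆ 𝓛.conjDom g → 𝓛.conjSet P g ⊆ S → 𝓛.conjSet P g ∈ Δ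
  over_mem : ∀ P ∈ Δ, ∀ Q : Set L, 𝓛.IsSubgroup Q → Q ⊆ S → P ⊆ Q → Q ∈ Δ

/-- In a locality, `S` is a subgroup. -/
theorem IsLocality.isSubgroup {𝓛 : PartialGroup L} {p : ℕ} {Δ : Set (Set L)} {S : Set L}
    (hL : 𝓛.IsLocality p Δ S) : 𝓛.IsSubgroup S :=
  hL.isPSubgroup.1

/-! ### Normalizers of objects are groups -/

theorem inv_eq_of_prod_eq_one {a h : L} (hD : [a, h] ∈ 𝓛.D) (h1 : 𝓛.prod [a, h] = 𝓛.prod []) :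
    a = 𝓛.inv h := by
  have e2 : [a, h] ++ [𝓛.inv h] ∈ 𝓛.D := by
    have e5 := 𝓛.inv_append_mem _ (𝓛.mem_of_append [𝓛.inv h, 𝓛.inv a] [a, h]
      (by simpa using 𝓛.inv_append_mem _ hD)).1
    have e6 : [a, h, 𝓛.inv h] ++ [𝓛.inv a] ∈ 𝓛.D := by simpa [𝓛.inv_inv] using e5
    exact (𝓛.mem_of_append _ _ e6).1
  have e3 := 𝓛.prod_collapse [] [a, h] [𝓛.inv h] e2
  have e4 := 𝓛.prod_collapse [a] [h, 𝓛.inv h] [] e2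
  have e5 : 𝓛.prod [h, 𝓛.inv h] = 𝓛.prod [] := by
    have := 𝓛.prod_inv_append [𝓛.inv h] (𝓛.single_mem _)
    simpa [𝓛.inv_inv] using this
  have e6 := 𝓛.prod_collapse [a] [] [] (𝓛.single_mem _)
  have e7 := 𝓛.prod_collapse [] [] [𝓛.inv h] (𝓛.single_mem _)
  simp only [List.nil_append, List.append_nil, List.cons_append, h1, e5, 𝓛.prod_single]
    at e3 e4 e6 e7
  rw [e6, ← e4, e3, ← e7]

theorem inv_conj {x f : L} (hx : [𝓛.inv f, x, f] ∈ 𝓛.D) :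
    𝓛.conj x f ∈ 𝓛.conjDom (𝓛.inv f) ∧ 𝓛.conj (𝓛.conj x f) (𝓛.inv f) = x := by
  have e1 : [f, 𝓛.inv f, x, f] ∈ 𝓛.D := by
    have := 𝓛.inv_append_mem _ hx
    refine (𝓛.mem_of_append [𝓛.inv f, 𝓛.inv x] _ ?_).2
    simpa [𝓛.inv_inv] using this
  have e2 : [f, 𝓛.inv f, x, f, 𝓛.inv f] ∈ 𝓛.D := by
    have h1 : [𝓛.inv f, 𝓛.inv x, f, 𝓛.inv f] ∈ 𝓛.D := by
      refine (𝓛.mem_of_append _ [f, 𝓛.inv f, x, f] ?_).1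
      simpa [𝓛.inv_inv] using 𝓛.inv_append_mem _ e1
    have := 𝓛.inv_append_mem _ h1
    refine (𝓛.mem_of_append _ [𝓛.inv x, f, 𝓛.inv f] ?_).1
    simpa [𝓛.inv_inv] using this
  have e5 : 𝓛.prod [f, 𝓛.inv f] = 𝓛.prod [] := by
    have := 𝓛.prod_inv_append [𝓛.inv f] (𝓛.single_mem _)
    simpa [𝓛.inv_inv] using this
  refine ⟨?_, ?_⟩
  · have := 𝓛.collapse_mem [f] [𝓛.inv f, x, f] [𝓛.inv f] e2
    simpa [conjDom, conj, 𝓛.inv_inv] using this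
  · have a1 := 𝓛.prod_collapse [f] [𝓛.inv f, x, f] [𝓛.inv f] e2
    have a2 := 𝓛.prod_collapse [] [f, 𝓛.inv f] [x, f, 𝓛.inv f] e2
    have d2 := 𝓛.collapse_mem [] [f, 𝓛.inv f] [x, f, 𝓛.inv f] e2
    have a3 := 𝓛.prod_collapse [𝓛.prod [f, 𝓛.inv f], x] [f, 𝓛.inv f] [] d2
    have d3 := 𝓛.collapse_mem [𝓛.prod [f, 𝓛.inv f], x] [f, 𝓛.inv f] [] d2
    have a4 := 𝓛.prod_collapse [] [] [x] (𝓛.single_mem x)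
    have d5 := 𝓛.collapse_mem [] [] [x] (𝓛.single_mem x)
    have a5 := 𝓛.prod_collapse [𝓛.prod [], x] [] [] d5
    simp only [List.nil_append, List.append_nil, List.cons_append, e5, 𝓛.prod_single]
      at a1 a2 a3 a4 a5
    simp only [conj, 𝓛.inv_inv]
    rw [← a1, a2, a3, ← a5, ← a4]

theorem one_mem_normalizer (P : Set L) : 𝓛.prod [] ∈ 𝓛.normalizer P := by
  have hnil : 𝓛.inv (𝓛.prod []) = 𝓛.prod [] := by
    have d := 𝓛.collapse_mem [] [] [𝓛.prod []] (𝓛.single_mem _)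
    have a := 𝓛.prod_collapse [] [] [𝓛.prod []] (𝓛.single_mem _)
    refine (𝓛.inv_eq_of_prod_eq_one d ?_).symm
    exact a.symm.trans (𝓛.prod_single _)
  have key : ∀ x, [𝓛.prod [], x, 𝓛.prod []] ∈ 𝓛.D ∧ 𝓛.prod [𝓛.prod [], x, 𝓛.prod []] = x := by
    intro x
    have a4 := 𝓛.prod_collapse [] [] [x] (𝓛.single_mem x)
    have d5 := 𝓛.collapse_mem [] [] [x] (𝓛.single_mem x)
    have a5 := 𝓛.prod_collapse [𝓛.prod [], x] [] [] d5
    exact ⟨𝓛.collapse_mem [𝓛.prod [], x] [] [] d5,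
      a5.symm.trans (a4.symm.trans (𝓛.prod_single x))⟩
  refine ⟨fun x _ => ?_, ?_⟩
  · simpa [conjDom, hnil] using (key x).1
  · simp [conjSet, conj, hnil, (key _).2]

theorem inv_mem_normalizer {P : Set L} {f : L} (hf : f ∈ 𝓛.normalizer P) :
    𝓛.inv f ∈ 𝓛.normalizer P := by
  obtain ⟨h1, h2⟩ := hf
  refine ⟨fun y hy => ?_, ?_⟩
  · rw [← h2] at hy
    obtain ⟨x, hx, rfl⟩ := hy
    exact (𝓛.inv_conj (h1 hx)).1
  · ext y
    constructor
    · rintro ⟨z, hz, rfl⟩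
      rw [← h2] at hz
      obtain ⟨x, hx, rfl⟩ := hz
      simpa [(𝓛.inv_conj (h1 hx)).2] using hx
    · intro hy
      refine ⟨𝓛.conj y f, ?_, (𝓛.inv_conj (h1 hy)).2⟩
      rw [← h2]
      exact ⟨y, hy, rfl⟩

namespace IsLocality

variable {𝓛} {p : ℕ} {Δ : Set (Set L)} {S : Set L}

theorem word_mem (hL : 𝓛.IsLocality p Δ S) {P : Set L} (hP : P ∈ Δ) (w : List L)
    (hw : ∀ f ∈ w, f ∈ 𝓛.normalizer P) : w ∈ 𝓛.D :=
  (hL.mem_D_iff w).2 ⟨fun _ => P, fun _ _ => hP, fun _ hi => hw _ (List.getElem_mem hi)⟩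

theorem subset_normalizer (hL : 𝓛.IsLocality p Δ S) {P : Set L} (hP : P ∈ Δ) :
    P ⊆ 𝓛.normalizer P := by
  obtain ⟨hs, -⟩ := hL.subgroup_of_mem P hP
  have key : ∀ f ∈ P, P ⊆ 𝓛.conjDom f ∧ 𝓛.conjSet P f ⊆ P := by
    intro f hf
    have hw : ∀ x ∈ P, ∀ g ∈ [𝓛.inv f, x, f], g ∈ P := by
      intro x hx g hg
      simp only [List.mem_cons, List.not_mem_nil, or_false] at hg
      rcases hg with rfl | rfl | rfl
      exacts [hs.1.1 _ hf, hx, hf]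
    refine ⟨fun x hx => hs.2 _ (hw x hx), ?_⟩
    rintro _ ⟨x, hx, rfl⟩
    exact hs.1.2 _ (hs.2 _ (hw x hx)) (hw x hx)
  intro f hf
  refine ⟨(key f hf).1, (key f hf).2.antisymm fun y hy => ?_⟩
  have h' := hs.1.1 f hf
  have hy' := (key _ h').1 hy
  have := (𝓛.inv_conj hy').2
  rw [𝓛.inv_inv] at this
  exact ⟨_, (key _ h').2 ⟨y, hy, rfl⟩, this⟩

theorem mul_mem_normalizer (hL : 𝓛.IsLocality p Δ S) {P : Set L} (hP : P ∈ Δ) {f g : L}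
    (hf : f ∈ 𝓛.normalizer P) (hg : g ∈ 𝓛.normalizer P) :
    𝓛.prod [f, g] ∈ 𝓛.normalizer P := by
  have hf' := 𝓛.inv_mem_normalizer hf
  have hg' := 𝓛.inv_mem_normalizer hg
  have hinv : 𝓛.prod [𝓛.inv g, 𝓛.inv f] = 𝓛.inv (𝓛.prod [f, g]) := by
    have d : [𝓛.inv g, 𝓛.inv f, f, g] ∈ 𝓛.D :=
      hL.word_mem hP _ (by simp [hf, hg, hf', hg'])
    have d1 := 𝓛.collapse_mem [] [𝓛.inv g, 𝓛.inv f] [f, g] d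
    have a1 := 𝓛.prod_collapse [] [𝓛.inv g, 𝓛.inv f] [f, g] d
    have d2 := 𝓛.collapse_mem [𝓛.prod [𝓛.inv g, 𝓛.inv f]] [f, g] [] (by simpa using d1)
    have a2 := 𝓛.prod_collapse [𝓛.prod [𝓛.inv g, 𝓛.inv f]] [f, g] [] (by simpa using d1)
    have a3 := 𝓛.prod_inv_append [f, g] (hL.word_mem hP _ (by simp [hf, hg]))
    simp only [List.nil_append, List.append_nil, List.cons_append, List.map_cons, List.map_nil,
      List.reverse_cons, List.reverse_nil] at d2 a1 a2 a3
    exact 𝓛.inv_eq_of_prod_eq_one d2 (by rw [← a2, ← a1, a3])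
  have key : ∀ x ∈ P, x ∈ 𝓛.conjDom (𝓛.prod [f, g]) ∧
      𝓛.conj x (𝓛.prod [f, g]) = 𝓛.conj (𝓛.conj x f) g := by
    intro x hx
    have hx' := hL.subset_normalizer hP hx
    have d : [𝓛.inv g, 𝓛.inv f, x, f, g] ∈ 𝓛.D :=
      hL.word_mem hP _ (by simp [hf, hg, hf', hg', hx'])
    have d1 := 𝓛.collapse_mem [] [𝓛.inv g, 𝓛.inv f] [x, f, g] d
    have a1 := 𝓛.prod_collapse [] [𝓛.inv g, 𝓛.inv f] [x, f, g] d
    have d2 := 𝓛.collapse_mem [𝓛.prod [𝓛.inv g, 𝓛.inv f], x] [f, g] [] (by simpa using d1)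
    have a2 := 𝓛.prod_collapse [𝓛.prod [𝓛.inv g, 𝓛.inv f], x] [f, g] [] (by simpa using d1)
    have a3 := 𝓛.prod_collapse [𝓛.inv g] [𝓛.inv f, x, f] [g] d
    simp only [List.nil_append, List.append_nil, List.cons_append, hinv] at d2 a1 a2 a3
    refine ⟨d2, ?_⟩
    simp only [conj]
    rw [← a2, ← a1, a3]
  refine ⟨fun x hx => (key x hx).1, ?_⟩
  have e : 𝓛.conjSet P (𝓛.prod [f, g]) = 𝓛.conjSet (𝓛.conjSet P f) g := by
    rw [conjSet, conjSet, conjSet, Set.image_image]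
    exact Set.image_congr fun x hx => (key x hx).2
  rw [e, hf.2, hg.2]

/-- In a locality, the normalizer of an object is a subgroup. -/
theorem isSubgroup_normalizer (hL : 𝓛.IsLocality p Δ S) {P : Set L} (hP : P ∈ Δ) :
    𝓛.IsSubgroup (𝓛.normalizer P) := by
  refine ⟨⟨fun f hf => 𝓛.inv_mem_normalizer hf, fun w _ hw => ?_⟩, hL.word_mem hP⟩
  induction w with
  | nil => exact 𝓛.one_mem_normalizer P
  | cons f w ih =>
    have hw' : ∀ g ∈ w, g ∈ 𝓛.normalizer P := fun g hg => hw g (List.mem_cons_of_mem _ hg)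
    have a := 𝓛.prod_collapse [f] w [] (by simpa using hL.word_mem hP _ hw)
    simp only [List.append_nil, List.cons_append, List.nil_append] at a
    rw [a]
    exact hL.mul_mem_normalizer hP (hw f List.mem_cons_self) (ih (hL.word_mem hP _ hw') hw')

/-- The group `N_L(P)` for an object `P` of a locality. -/
abbrev NormalizerGroup (hL : 𝓛.IsLocality p Δ S) {P : Set L} (hP : P ∈ Δ) : Type u :=
  (hL.isSubgroup_normalizer hP).Elems

/-- The locality is of objective characteristic `p`. -/
def IsObjectiveCharP (hL : 𝓛.IsLocality p Δ S) : Prop :=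
  ∀ (P : Set L) (hP : P ∈ Δ), IsCharP p (hL.NormalizerGroup hP)

/-- The union of the groups `O_{p'}(N_L(P))` over all objects `P`, as a subset of `L`. -/
def Theta (hL : 𝓛.IsLocality p Δ S) : Set L :=
  {x | ∃ (P : Set L) (hP : P ∈ Δ), ∃ y ∈ OpPrime p (hL.NormalizerGroup hP), y.val = x}

/-- The fusion system `F_S(L)` over `S`: the smallest one that contains every conjugation map
`x ↦ x^g` between subgroups of `S`, for `g ∈ L`. -/
def fusionSystem (hL : 𝓛.IsLocality p Δ S) : FusionSystem hL.isSubgroup.Elems :=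
  sInf {F | ∀ (P Q : Subgroup hL.isSubgroup.Elems) (φ : P →* Q) (g : L),
    (∀ x : P, x.1.val ∈ 𝓛.conjDom g ∧ (φ x).1.val = 𝓛.conj x.1.val g) → φ ∈ F.Hom P Q}

end IsLocality

/-! ### The quotient by a partial normal subgroup -/

/-- The right coset `N f = {Π(n, f) : n ∈ N, (n, f) ∈ D}`. -/
def rightCoset (N : Set L) (f : L) : Set L := {x | ∃ n ∈ N, [n, f] ∈ 𝓛.D ∧ 𝓛.prod [n, f] = x}

/-- The underlying set of `L / N`: the right cosets of `N` which are maximal under inclusion. -/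
def MaxRightCoset (N : Set L) : Type u :=
  {C : Set L // Maximal (fun X => ∃ f, X = 𝓛.rightCoset N f) C}

/-- The partial group `𝓠` on the set of maximal right cosets of `N` is the quotient `L / N`, with
canonical projection `ρ`: each `g` lies in exactly one maximal right coset, namely `ρ g`, the
domain of `𝓠` consists of the images under `ρ` of the words in the domain of `L`, and the product
of such an image is the image of the product. This determines `ρ` and `𝓠`. -/
structure IsQuotient (N : Set L) (𝓠 : PartialGroup (𝓛.MaxRightCoset N))
    (ρ : L → 𝓛.MaxRightCoset N) : Prop where
  mem_iff : ∀ (g : L) (C : 𝓛.MaxRightCoset N), g ∈ C.1 ↔ C = ρ g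
  dom : 𝓠.D = List.map ρ '' 𝓛.D
  prod_map : ∀ w ∈ 𝓛.D, 𝓠.prod (w.map ρ) = ρ (𝓛.prod w)

end PartialGroup

/-!
Write `Θ(P) = O_{p'}(N_L(P))` for an object `P`, and `S_f` for the largest object that `f`
conjugates into `S`.

The input from finite group theory is `le_OpPrime_of_normal_in_normalizer`: if `G` is almost of
characteristic `p` and `T` is a `p`-subgroup of `G`, then normal `p'`-subgroups of `N_G(T)` lie in
`O_{p'}(G)`. Applied to `N_L(P)` and to `N_L(Q)` it gives the balance property
`Θ(Q) = Θ(P) ∩ N_L(Q)` for objects `P ≤ Q` (`IsLocality.theta_eq`). It follows that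
`x ∈ Θ` lies in `Θ(Q)` for *every* object `Q ≤ S_x` (`IsLocality.mem_theta_of_subset_sf`), so that
products and conjugates of elements of `Θ` can be computed inside a single group `Θ(P)`. This
makes `Θ` partial normal, and `Θ ∩ S = 1` since each `Θ(P)` is a `p'`-group.

For the quotient, call `f` and `g` congruent over the object `P` (`IsLocality.Rel`) if both
conjugate `P` to an object and `g ∈ Θ(P) f`. By balance this is compatible with products, inverses
and restriction of `P`. Congruence over a fixed `P` is an equivalence relation, but the relation
obtained by letting `P` vary need not be transitive, because objects may have too small an
intersection. This is overcome by `IsLocality.exists_rel_sf`: congruent elements `f` and `g` are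
both congruent to a common `h`, over the whole of `S_f` and of `S_g`. Hence each `f` is congruent
over `S_f` to an element `m` with maximal domain `S_m` (`IsLocality.IsMax`), and the maximal right
cosets of `Θ` are the sets `Θm = {g | g is congruent to m over S_g}` for such `m`. Words in the
domain may be replaced by words of representatives with maximal domain without changing the coset
of the product, which makes the product on cosets well defined.

Everything about the quotient then follows from `IsLocality.IsMax.conj_eq_of_conj_rho_eq`: if `m`
has maximal domain and the coset of `m` conjugates the coset of `x ∈ S` to the coset of `s ∈ S`,
then `x^m = s` already in `L`. Thus chains of objects, normalizers of objects, and conjugation maps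
between subgroups of `S` lift from `L/Θ` to `L`; the groups `N_{L/Θ}(Pρ)` are the groups
`N_L(P)/Θ(P)`, which are of characteristic `p` by hypothesis.
-/

/-! ### Coprime action in finite groups -/

section Groups

variable {G : Type u} [Group G] {p : ℕ}

theorem eq_one_of_pow_prime_pow_eq_one {x : G} {k : ℕ} (hx : x ^ p ^ k = 1)
    (hc : (orderOf x).Coprime p) : x = 1 := by
  rw [← orderOf_eq_one_iff]
  exact (hc.pow_right k).eq_one_of_dvd (orderOf_dvd_of_pow_eq_one hx)

theorem IsPGroup.eq_one_of_coprime {T : Subgroup G} (hT : IsPGroup p T) {x : G} (hx : x ∈ T)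
    (hc : (orderOf x).Coprime p) : x = 1 := by
  obtain ⟨k, hk⟩ := hT ⟨x, hx⟩
  exact eq_one_of_pow_prime_pow_eq_one (by simpa [Subtype.ext_iff] using hk) hc

theorem orderOf_coprime_of_mem {X : Subgroup G} (h : (Nat.card X).Coprime p) {x : G}
    (hx : x ∈ X) : (orderOf x).Coprime p := by
  have := orderOf_dvd_natCard (⟨x, hx⟩ : X)
  rw [← Subgroup.orderOf_coe] at this
  exact h.coprime_dvd_left this

theorem isPGroup_zpowers {x : G} {k : ℕ} (hx : x ^ p ^ k = 1) :
    IsPGroup p (Subgroup.zpowers x) := by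
  rintro ⟨_, i, rfl⟩
  refine ⟨k, Subtype.ext ?_⟩
  change (x ^ i) ^ p ^ k = 1
  rw [← zpow_natCast, ← zpow_mul, mul_comm, zpow_mul, zpow_natCast, hx, one_zpow]

/-- `O_{p'}(G)`, defined as a join, is itself a `p'`-group. -/
theorem OpPrime.card_coprime (p : ℕ) (G : Type u) [Group G] [Finite G] :
    (Nat.card (OpPrime p G)).Coprime p := by
  let A : Set (Subgroup G) := {K : Subgroup G | K.Normal ∧ (Nat.card K).Coprime p}
  have hsup : SupClosed A := by
    rintro H ⟨hH, hH'⟩ K ⟨hK, hK'⟩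
    refine ⟨inferInstance, ?_⟩
    rw [← Subgroup.card_mul_index (K.subgroupOf (H ⊔ K))]
    have h1 : (K.subgroupOf (H ⊔ K)).index ∣ Nat.card H := by
      change K.relIndex (H ⊔ K) ∣ _
      rw [Subgroup.relIndex_sup_right]
      exact Subgroup.relIndex_dvd_card _ _
    have h2 : Nat.card (K.subgroupOf (H ⊔ K)) = Nat.card K :=
      Nat.card_congr (Subgroup.subgroupOfEquivOfLe le_sup_right).toEquiv
    rw [h2]
    exact Nat.Coprime.mul_left hK' (hH'.coprime_dvd_left h1)
  exact (hsup.sSup_mem A.toFinite ⟨inferInstance, by simp⟩ le_rfl).2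

instance Op.normal (p : ℕ) (G : Type u) [Group G] : (Op p G).Normal :=
  Subgroup.sSup_normal _ fun _ hK => hK.1

/-- `O_p(G)`, defined as a join, is itself a `p`-group. -/
theorem Op.isPGroup (p : ℕ) (G : Type u) [Group G] [Finite G] : IsPGroup p (Op p G) := by
  let A : Set (Subgroup G) := {K : Subgroup G | K.Normal ∧ IsPGroup p K}
  have hsup : SupClosed A := by
    rintro H ⟨hH, hH'⟩ K ⟨hK, hK'⟩
    exact ⟨inferInstance, hH'.to_sup_of_normal_right hK'⟩
  exact (hsup.sSup_mem A.toFinite ⟨inferInstance, IsPGroup.of_bot⟩ le_rfl).2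

theorem Op.map_le {H : Type v} [Group H] (e : G ≃* H) {x : G} (hx : x ∈ Op p G) :
    e x ∈ Op p H := by
  have h : Op p G ≤ (Op p H).comap e.toMonoidHom := by
    refine sSup_le fun K hK => ?_
    rw [← Subgroup.map_le_iff_le_comap]
    exact le_sSup ⟨hK.1.map _ e.surjective, hK.2.map _⟩
  exact h hx

theorem OpPrime.map_le {H : Type v} [Group H] (e : G ≃* H) {x : G}
    (hx : x ∈ OpPrime p G) : e x ∈ OpPrime p H := by
  have h : OpPrime p G ≤ (OpPrime p H).comap e.toMonoidHom := by
    refine sSup_le fun K hK => ?_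
    rw [← Subgroup.map_le_iff_le_comap]
    refine le_sSup ⟨hK.1.map _ e.surjective, ?_⟩
    rw [← Nat.card_congr (K.equivMapOfInjective e.toMonoidHom e.injective).toEquiv]
    exact hK.2
  exact h hx

theorem IsCharP.of_mulEquiv {H : Type v} [Group H] (e : G ≃* H) (h : IsCharP p G) :
    IsCharP p H := by
  intro x hx
  have h1 : e.symm x ∈ Op p G := by
    apply h
    rw [Subgroup.mem_centralizer_iff] at hx ⊢
    intro y hy
    apply e.injective
    simpa using hx (e y) (Op.map_le e hy)
  simpa using Op.map_le e h1

/-- The conjugacy part of Sylow's theorem in `KT`, where `T` is a Sylow `p`-subgroup: a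
`p`-subgroup of `KT` is conjugate into `T` by an element of `K`. -/
theorem exists_conj_mem_of_le_sup [Finite G] (hp : p.Prime) {K T A : Subgroup G} [K.Normal]
    (hK : (Nat.card K).Coprime p) (hT : IsPGroup p T) (hA : IsPGroup p A) (hle : A ≤ K ⊔ T) :
    ∃ k ∈ K, ∀ a ∈ A, k⁻¹ * a * k ∈ T := by
  have := Fact.mk hp
  set M := K ⊔ T with hM
  have hTM : T ≤ M := le_sup_right
  have hTp : IsPGroup p (T.subgroupOf M) := hT.of_equiv (Subgroup.subgroupOfEquivOfLe hTM).symm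
  have hAp : IsPGroup p (A.subgroupOf M) := hA.of_equiv (Subgroup.subgroupOfEquivOfLe hle).symm
  have hidx : ¬ p ∣ (T.subgroupOf M).index := by
    -- `|KT : T| = |K : K ∩ T|` divides `|K|`.
    have h1 : (T.subgroupOf M).index ∣ Nat.card K := by
      change T.relIndex M ∣ _
      have hcard : Nat.card M = Nat.card T * T.relIndex M := by
        rw [← Nat.card_congr (Subgroup.subgroupOfEquivOfLe hTM).toEquiv]
        exact (Subgroup.card_mul_index _).symm
      have hcard' : Nat.card M = Nat.card K * K.relIndex T := by
        rw [← Subgroup.relIndex_sup_left T K,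
          ← Nat.card_congr (Subgroup.subgroupOfEquivOfLe (le_sup_left : K ≤ M)).toEquiv]
        exact (Subgroup.card_mul_index _).symm
      obtain ⟨c, hc⟩ := Subgroup.relIndex_dvd_card K T
      rw [hcard', hc] at hcard
      refine ⟨c, ?_⟩
      have hpos : 0 < K.relIndex T :=
        Nat.pos_of_ne_zero fun h0 => by
          rw [h0, zero_mul] at hc
          exact Nat.card_pos.ne' hc
      apply Nat.eq_of_mul_eq_mul_left hpos
      linarith
    intro h
    exact hp.one_lt.ne' ((hK.coprime_dvd_left h1).symm.eq_one_of_dvd h)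
  obtain ⟨Q, hQ⟩ := hAp.exists_le_sylow
  obtain ⟨g, hg⟩ := MulAction.exists_smul_eq M Q (hTp.toSylow hidx)
  obtain ⟨k, hk, t, ht, hkt⟩ := Subgroup.mem_sup_of_normal_left.1 (g⁻¹).2
  refine ⟨k, hk, fun a ha => ?_⟩
  have h1 : (⟨a, hle ha⟩ : M) ∈ (Q : Subgroup M) := hQ (by simpa [Subgroup.mem_subgroupOf] using ha)
  have h2 : g * ⟨a, hle ha⟩ * g⁻¹ ∈ (g • Q : Sylow p M) :=
    Subgroup.smul_mem_pointwise_smul _ (MulAut.conj g) _ h1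
  rw [hg] at h2
  have h3 : (g : G) * a * (g : G)⁻¹ ∈ T := h2
  have h4 : (g : G)⁻¹ = k * t := by simpa using hkt.symm
  have h5 : (g : G) = t⁻¹ * k⁻¹ := by rw [← inv_inv (g : G), h4, mul_inv_rev]
  rw [h4, h5] at h3
  have h6 := T.mul_mem (T.mul_mem ht h3) (T.inv_mem ht)
  simpa [mul_assoc] using h6

/-- A `p'`-element acting on a `p`-group `U` acts trivially as soon as its fixed points contain
their own centralizer in `U`. If `n` normalizes the fixed point group `C`, then `n (n^x)⁻¹`
centralizes `C`, so lies in `C`; hence `x` moves `n` by a fixed point of `p`-power order, which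
must be trivial. Thus `C` is self-normalizing in `U`. -/
theorem commute_of_centralizer_fixedPoints_le [Finite G] (hp : p.Prime) {U : Subgroup G}
    (hU : IsPGroup p U) {x : G} (hx : (orderOf x).Coprime p) (hxU : ∀ u ∈ U, x⁻¹ * u * x ∈ U)
    (h : ∀ u ∈ U, (∀ c ∈ U, Commute c x → Commute u c) → Commute u x) :
    ∀ u ∈ U, Commute u x := by
  have := Fact.mk hp
  have := hU.isNilpotent
  let C : Subgroup U := (Subgroup.centralizer {x}).subgroupOf U
  have hC : ∀ u : U, u ∈ C ↔ Commute (u : G) x := by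
    intro u
    simp only [C, Subgroup.mem_subgroupOf, Subgroup.mem_centralizer_singleton_iff]
    exact ⟨fun h => h, fun h => h⟩
  have htop : C = ⊤ := by
    by_contra hne
    have hlt := Group.normalizerCondition_of_isNilpotent (G := U) C (lt_top_iff_ne_top.2 hne)
    obtain ⟨n, hn, hnC⟩ := SetLike.exists_of_lt hlt
    apply hnC
    rw [hC]
    rw [Subgroup.mem_normalizer_iff''] at hn
    set m : G := x⁻¹ * n * x with hm
    have hmU : m ∈ U := hxU n n.2
    set d : G := n * m⁻¹ with hd
    have hdU : d ∈ U := U.mul_mem n.2 (U.inv_mem hmU)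
    have hdx : Commute d x := by
      apply h d hdU
      intro c hc hcx
      have h1 : Commute ((n : G)⁻¹ * c * n) x := (hC _).1 ((hn ⟨c, hc⟩).1 ((hC _).2 hcx))
      have h2 : (n : G)⁻¹ * c * n = m⁻¹ * c * m := by
        have e1 : x⁻¹ * ((n : G)⁻¹ * c * n) * x = (n : G)⁻¹ * c * n := by
          rw [mul_assoc, h1.eq]; simp
        have e2 : x⁻¹ * c * x = c := by rw [mul_assoc, hcx.eq]; simp
        calc (n : G)⁻¹ * c * n = x⁻¹ * ((n : G)⁻¹ * c * n) * x := e1.symm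
          _ = m⁻¹ * (x⁻¹ * c * x) * m := by rw [hm]; group
          _ = m⁻¹ * c * m := by rw [e2]
      change n * m⁻¹ * c = c * (n * m⁻¹)
      have h3 : c = n * (m⁻¹ * c * m) * (n : G)⁻¹ := by rw [← h2]; group
      calc n * m⁻¹ * c = (n * (m⁻¹ * c * m) * (n : G)⁻¹) * (n * m⁻¹) := by group
        _ = c * (n * m⁻¹) := by rw [← h3]
    have hnx : x⁻¹ * n * x = d⁻¹ * n := by rw [hd, hm]; group
    have hpow : ∀ k : ℕ, (x ^ k)⁻¹ * n * x ^ k = (d ^ k)⁻¹ * n := by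
      intro k
      induction k with
      | zero => simp
      | succ k ih =>
        have e : x⁻¹ * (d ^ k)⁻¹ * x = (d ^ k)⁻¹ := by
          rw [mul_assoc, ((hdx.pow_left k).inv_left).eq]; simp
        calc (x ^ (k + 1))⁻¹ * n * x ^ (k + 1) = x⁻¹ * ((x ^ k)⁻¹ * n * x ^ k) * x := by
              rw [pow_succ]; group
          _ = (x⁻¹ * (d ^ k)⁻¹ * x) * (x⁻¹ * n * x) := by rw [ih]; group
          _ = (d ^ (k + 1))⁻¹ * n := by rw [e, hnx, pow_succ']; group
    have hd1 : d ^ orderOf x = 1 := by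
      have := hpow (orderOf x)
      rw [pow_orderOf_eq_one] at this
      simpa using this
    have : d = 1 := hU.eq_one_of_coprime hdU (hx.coprime_dvd_left (orderOf_dvd_of_pow_eq_one hd1))
    rw [this] at hnx
    change (n : G) * x = x * n
    calc (n : G) * x = x * (x⁻¹ * n * x) := by group
      _ = x * n := by rw [hnx]; simp
  intro u hu
  exact (hC ⟨u, hu⟩).1 (htop ▸ Subgroup.mem_top _)

/-- If `G` is almost of characteristic `p` and `T` is a `p`-subgroup of `G`, then every normal
`p'`-subgroup `X` of `N_G(T)` lies in `O_{p'}(G)`: modulo `O_{p'}(G)`, an element of `X` satisfies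
the hypothesis of `commute_of_centralizer_fixedPoints_le` on `O_p(G) T`. -/
theorem le_OpPrime_of_normal_in_normalizer [Finite G] (hp : p.Prime) (hG : IsAlmostCharP p G)
    {T X : Subgroup G} (hT : IsPGroup p T) (hX : ∀ x ∈ X, (orderOf x).Coprime p)
    (hXT : ∀ x ∈ X, ∀ t ∈ T, x⁻¹ * t * x ∈ T)
    (hNX : ∀ g, (∀ t ∈ T, g⁻¹ * t * g ∈ T) → ∀ x ∈ X, g⁻¹ * x * g ∈ X) :
    X ≤ OpPrime p G := by
  set K := OpPrime p G with hK
  have hKc : (Nat.card K).Coprime p := OpPrime.card_coprime p G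
  let π := QuotientGroup.mk' K
  have hπ : Function.Surjective π := QuotientGroup.mk'_surjective K
  have hker : ∀ g, π g = 1 ↔ g ∈ K := fun g => QuotientGroup.eq_one_iff g
  set R := Op p (G ⧸ K) with hR
  have hRp : IsPGroup p R := Op.isPGroup p _
  have hRN : ∀ r ∈ R, ∀ y, y⁻¹ * r * y ∈ R := fun r hr y => by
    have h := (inferInstance : R.Normal).conj_mem r hr y⁻¹
    rwa [inv_inv] at h
  have hTT : ∀ s ∈ T, ∀ t ∈ T, s⁻¹ * t * s ∈ T := fun s hs t ht =>
    T.mul_mem (T.mul_mem (T.inv_mem hs) ht) hs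
  -- `[T, X] ≤ T ∩ X = 1`.
  have hTX : ∀ t ∈ T, ∀ x ∈ X, Commute t x := by
    intro t ht x hx
    have h1 : t⁻¹ * (x⁻¹ * t * x) ∈ T := T.mul_mem (T.inv_mem ht) (hXT x hx t ht)
    have h2 : t⁻¹ * (x⁻¹ * t * x) ∈ X := by
      have := X.mul_mem (hNX t (hTT t ht) _ (X.inv_mem hx)) hx
      simpa [mul_assoc] using this
    have h3 := hT.eq_one_of_coprime h1 (hX _ h2)
    have h4 : x * (t * (t⁻¹ * (x⁻¹ * t * x))) = x * t := by rw [h3, mul_one]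
    simpa [mul_assoc, Commute, SemiconjBy] using h4
  intro x hx
  have hπx : (orderOf (π x)).Coprime p := (hX x hx).coprime_dvd_left (orderOf_map_dvd π x)
  let U := T.map π ⊔ R
  have hUp : IsPGroup p U := (hT.map π).to_sup_of_normal_right hRp
  have hU : ∀ u ∈ U, Commute u (π x) := by
    refine commute_of_centralizer_fixedPoints_le hp hUp hπx ?_ ?_
    · intro u hu
      obtain ⟨_, ⟨t, ht, rfl⟩, r, hr, rfl⟩ := Subgroup.mem_sup_of_normal_right.1 hu
      have h1 : (π x)⁻¹ * (π t * r) * π x = π (x⁻¹ * t * x) * ((π x)⁻¹ * r * (π x)) := by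
        simp [mul_assoc]
      rw [h1]
      refine U.mul_mem (le_sup_left (a := T.map π) ⟨_, hXT x hx t ht, rfl⟩)
        (le_sup_right (a := T.map π) ?_)
      exact hRN r hr _
    · -- The image of `T` is fixed by `x`, so an element `π g` of `U` that centralizes the fixed
      -- points of `x` centralizes the image of `T`.
      intro u hu hcent
      obtain ⟨g, rfl⟩ := hπ u
      have hgT : ∀ t ∈ T, g⁻¹ * t * g ∈ K ⊔ T := by
        intro t ht
        have hc := hcent (π t) (le_sup_left (a := T.map π) ⟨t, ht, rfl⟩)
          ((hTX t ht x hx).map π)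
        have h1 : g⁻¹ * t * g * t⁻¹ ∈ K := by
          rw [← hker, map_mul, map_mul, map_mul, map_inv, map_inv, mul_assoc (π g)⁻¹, ← hc.eq]
          simp
        have := Subgroup.mul_mem_sup h1 ht
        simpa using this
      -- A Frattini argument: `g` may be replaced by an element of `N_G(T)`.
      obtain ⟨k, hk, hkT⟩ := exists_conj_mem_of_le_sup hp (A := T.map (MulAut.conj g⁻¹).toMonoidHom)
        hKc hT (hT.map _) (by
          rintro _ ⟨t, ht, rfl⟩
          simpa using hgT t ht)
      have hn : ∀ t ∈ T, (g * k)⁻¹ * t * (g * k) ∈ T := by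
        intro t ht
        have := hkT _ ⟨t, ht, rfl⟩
        simpa [mul_assoc] using this
      have hgk : π g = π (g * k) := by rw [map_mul, (hker k).2 hk, mul_one]
      rw [hgk] at hu ⊢
      generalize g * k = n at hu hn ⊢
      obtain ⟨_, ⟨t, ht, rfl⟩, r, hr, hrn⟩ := Subgroup.mem_sup_of_normal_right.1 hu
      have hr' : r = π (t⁻¹ * n) := by rw [map_mul, ← hrn]; simp
      have hm : ∀ s ∈ T, (t⁻¹ * n)⁻¹ * s * (t⁻¹ * n) ∈ T := by
        intro s hs
        have := hn _ (hTT _ (T.inv_mem ht) s hs)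
        simpa [mul_assoc] using this
      -- `[t⁻¹ n, x]` lies in `X` and modulo `K` in `R`, where `p'`-elements are trivial.
      have hrx : Commute r (π x) := by
        have h1 : r⁻¹ * ((π x)⁻¹ * r * π x) ∈ R := by
          refine R.mul_mem (R.inv_mem hr) ?_
          exact hRN r hr _
        have h2 : (orderOf (r⁻¹ * ((π x)⁻¹ * r * π x))).Coprime p := by
          have h3 := X.mul_mem (hNX _ hm _ (X.inv_mem hx)) hx
          have h4 : r⁻¹ * ((π x)⁻¹ * r * π x) =
              π ((t⁻¹ * n)⁻¹ * x⁻¹ * (t⁻¹ * n) * x) := by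
            rw [hr']; simp only [map_mul, map_inv]; group
          rw [h4]
          exact (hX _ h3).coprime_dvd_left (orderOf_map_dvd π _)
        have h3 := hRp.eq_one_of_coprime h1 h2
        have h4 : π x * (r * (r⁻¹ * ((π x)⁻¹ * r * π x))) = π x * r := by rw [h3, mul_one]
        simpa [mul_assoc, Commute, SemiconjBy] using h4
      rw [← hrn]
      exact ((hTX t ht x hx).map π).mul_left hrx
  have hxR : π x ∈ R := by
    apply hG
    rw [Subgroup.mem_centralizer_iff]
    intro r hr
    exact (hU r (le_sup_right (a := T.map π) hr)).eq
  rw [← hker]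
  exact hRp.eq_one_of_coprime hxR hπx

end Groups

/-! ### Calculations in partial groups -/

namespace PartialGroup

section Basic

variable {L : Type u} (𝓛 : PartialGroup L)

/-- The product of two elements, meaningful when `[f, g]` lies in the domain. -/
def mul (f g : L) : L := 𝓛.prod [f, g]

theorem nil_mem : [] ∈ 𝓛.D := (𝓛.mem_of_append [] [𝓛.one] (𝓛.single_mem _)).1

theorem one_mul' (f : L) : 𝓛.mul 𝓛.one f = f :=
  (𝓛.prod_collapse [] [] [f] (𝓛.single_mem _)).symm.trans (𝓛.prod_single _)

theorem mul_one' (f : L) : 𝓛.mul f 𝓛.one = f :=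
  (𝓛.prod_collapse [f] [] [] (𝓛.single_mem _)).symm.trans (𝓛.prod_single _)

theorem inv_mul (f : L) : 𝓛.mul (𝓛.inv f) f = 𝓛.one :=
  𝓛.prod_inv_append [f] (𝓛.single_mem _)

theorem mul_inv (f : L) : 𝓛.mul f (𝓛.inv f) = 𝓛.one := by
  simpa [𝓛.inv_inv] using 𝓛.inv_mul (𝓛.inv f)

theorem prod_cons {f : L} {w : List L} (h : f :: w ∈ 𝓛.D) :
    𝓛.prod (f :: w) = 𝓛.mul f (𝓛.prod w) := by
  simpa [mul] using 𝓛.prod_collapse [f] w [] (by simpa using h)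

theorem mul_assoc_of_mem {f g h : L} (hD : [f, g, h] ∈ 𝓛.D) :
    𝓛.mul (𝓛.mul f g) h = 𝓛.mul f (𝓛.mul g h) :=
  (𝓛.prod_collapse [] [f, g] [h] hD).symm.trans (𝓛.prod_collapse [f] [g, h] [] hD)

theorem conj_eq_mul {x g : L} (hx : x ∈ 𝓛.conjDom g) :
    𝓛.conj x g = 𝓛.mul (𝓛.inv g) (𝓛.mul x g) :=
  𝓛.prod_collapse [𝓛.inv g] [x, g] [] hx

variable {𝓛}

theorem IsSubgroup.one_mem {H : Set L} (h : 𝓛.IsSubgroup H) : 𝓛.one ∈ H :=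
  h.1.2 _ 𝓛.nil_mem (by simp)

theorem IsSubgroup.inv_mem {H : Set L} (h : 𝓛.IsSubgroup H) {x : L} (hx : x ∈ H) :
    𝓛.inv x ∈ H := h.1.1 _ hx

theorem IsSubgroup.mul_mem {H : Set L} (h : 𝓛.IsSubgroup H) {x y : L} (hx : x ∈ H)
    (hy : y ∈ H) : 𝓛.mul x y ∈ H := by
  have hw : ∀ f ∈ [x, y], f ∈ H := by simp [hx, hy]
  exact h.1.2 _ (h.2 _ hw) hw

theorem IsSubgroup.mem_conjDom {H : Set L} (h : 𝓛.IsSubgroup H) {x y : L} (hx : x ∈ H)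
    (hy : y ∈ H) : x ∈ 𝓛.conjDom y :=
  h.2 _ (by simp [hx, hy, h.inv_mem hy])

theorem IsSubgroup.conj_mem {H : Set L} (h : 𝓛.IsSubgroup H) {x y : L} (hx : x ∈ H)
    (hy : y ∈ H) : 𝓛.conj x y ∈ H := by
  rw [𝓛.conj_eq_mul (h.mem_conjDom hx hy)]
  exact h.mul_mem (h.inv_mem hy) (h.mul_mem hx hy)

/-- A subset of a subgroup is a subgroup if it satisfies the usual closure conditions. -/
theorem IsSubgroup.of_subset {H K : Set L} (hK : 𝓛.IsSubgroup K) (hHK : H ⊆ K)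
    (h1 : 𝓛.one ∈ H) (hinv : ∀ x ∈ H, 𝓛.inv x ∈ H) (hmul : ∀ x ∈ H, ∀ y ∈ H, 𝓛.mul x y ∈ H) :
    𝓛.IsSubgroup H := by
  refine ⟨⟨hinv, fun w hw hwH => ?_⟩, fun w hw => hK.2 _ fun f hf => hHK (hw f hf)⟩
  clear hw
  induction w with
  | nil => exact h1
  | cons f w ih =>
    rw [𝓛.prod_cons (hK.2 _ fun f hf => hHK (hwH f hf))]
    exact hmul _ (hwH f List.mem_cons_self) _ (ih fun g hg => hwH g (List.mem_cons_of_mem _ hg))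

theorem IsSubgroup.inter {H K : Set L} (hH : 𝓛.IsSubgroup H) (hK : 𝓛.IsSubgroup K) :
    𝓛.IsSubgroup (H ∩ K) :=
  hH.of_subset Set.inter_subset_left ⟨hH.one_mem, hK.one_mem⟩
    (fun _ hx => ⟨hH.inv_mem hx.1, hK.inv_mem hx.2⟩)
    (fun _ hx _ hy => ⟨hH.mul_mem hx.1 hy.1, hK.mul_mem hx.2 hy.2⟩)

namespace IsSubgroup.Elems

variable {H : Set L} {h : 𝓛.IsSubgroup H}

theorem ext {x y : h.Elems} (hxy : x.val = y.val) : x = y := Subtype.ext hxy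

theorem val_mk (x : L) (hx : x ∈ H) : (h.mk x hx).val = x := rfl

theorem val_mul (x y : h.Elems) : (x * y).val = 𝓛.mul x.val y.val := rfl

theorem val_conj (x y : h.Elems) : (y⁻¹ * x * y).val = 𝓛.conj x.val y.val := by
  rw [𝓛.conj_eq_mul (h.mem_conjDom x.mem y.mem), mul_assoc]
  rfl

theorem val_pow_congr {K : Set L} {k : 𝓛.IsSubgroup K} {x : h.Elems} {y : k.Elems}
    (hxy : x.val = y.val) (n : ℕ) : (x ^ n).val = (y ^ n).val := by
  induction n with
  | zero => rfl
  | succ n ih => rw [pow_succ, pow_succ, val_mul, val_mul, ih, hxy]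

theorem orderOf_congr {K : Set L} {k : 𝓛.IsSubgroup K} {x : h.Elems} {y : k.Elems}
    (hxy : x.val = y.val) : orderOf x = orderOf y := by
  rw [orderOf_eq_orderOf_iff]
  intro n
  have := val_pow_congr hxy n
  constructor
  · intro hn
    exact ext (by rw [← this, hn]; rfl)
  · intro hn
    exact ext (by rw [this, hn]; rfl)

instance [Finite L] : Finite h.Elems := Finite.of_injective val fun _ _ => ext

end IsSubgroup.Elems

/-- The intersection of the subgroup `H` with the subgroup `K`, as a subgroup of the group `K`. -/
def IsSubgroup.restrict {H K : Set L} (h : 𝓛.IsSubgroup H) (k : 𝓛.IsSubgroup K) :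
    Subgroup k.Elems where
  carrier := {x | x.val ∈ H}
  mul_mem' hx hy := h.mul_mem hx hy
  one_mem' := h.one_mem
  inv_mem' hx := h.inv_mem hx

theorem IsSubgroup.mem_restrict {H K : Set L} {h : 𝓛.IsSubgroup H} {k : 𝓛.IsSubgroup K}
    {x : k.Elems} : x ∈ h.restrict k ↔ x.val ∈ H := Iff.rfl

theorem IsSubgroup.restrict_isPGroup {p : ℕ} {H K : Set L} (h : 𝓛.IsSubgroup H)
    (k : 𝓛.IsSubgroup K) (hp : IsPGroup p h.Elems) : IsPGroup p (h.restrict k) := by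
  rintro ⟨x, hx⟩
  obtain ⟨n, hn⟩ := hp (h.mk x.val hx)
  refine ⟨n, Subtype.ext (Elems.ext ?_)⟩
  have := Elems.val_pow_congr (x := h.mk x.val hx) (y := x) rfl (p ^ n)
  rw [hn] at this
  exact this.symm

theorem IsSubgroup.isPGroup_of_subset {p : ℕ} {H K : Set L} (h : 𝓛.IsSubgroup H)
    (k : 𝓛.IsSubgroup K) (hHK : H ⊆ K) (hp : IsPGroup p k.Elems) : IsPGroup p h.Elems := by
  intro x
  obtain ⟨n, hn⟩ := hp (k.mk x.val (hHK x.mem))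
  refine ⟨n, Elems.ext ?_⟩
  have := Elems.val_pow_congr (x := k.mk x.val (hHK x.mem)) (y := x) rfl (p ^ n)
  rw [hn] at this
  exact this.symm

/-- A subgroup of the group `K`, viewed as a subset of `L`, is a subgroup of the partial group. -/
theorem IsSubgroup.of_subgroup {K : Set L} (k : 𝓛.IsSubgroup K) (A : Subgroup k.Elems) :
    𝓛.IsSubgroup (IsSubgroup.Elems.val '' (A : Set k.Elems)) := by
  refine k.of_subset ?_ ⟨1, A.one_mem, rfl⟩ ?_ ?_
  · rintro _ ⟨x, -, rfl⟩
    exact x.mem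
  · rintro _ ⟨x, hx, rfl⟩
    exact ⟨x⁻¹, A.inv_mem hx, rfl⟩
  · rintro _ ⟨x, hx, rfl⟩ _ ⟨y, hy, rfl⟩
    exact ⟨x * y, A.mul_mem hx hy, rfl⟩

end Basic

/-! ### Conjugation between objects of a locality -/

section Arrows

variable {L : Type u} (𝓛 : PartialGroup L) (Δ : Set (Set L)) (S : Set L)

/-- Conjugation by `f` is defined on the object `P` and carries it to the object `Q`. -/
structure Arrow (P : Set L) (f : L) (Q : Set L) : Prop where
  src : P ∈ Δ
  tgt : Q ∈ Δ
  sub : P ⊆ 𝓛.conjDom f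
  eq : 𝓛.conjSet P f = Q

/-- The entries of the word `w` successively conjugate the object `P` through objects to `Q`. -/
def Chain : List L → Set L → Set L → Prop
  | [], P, Q => P ∈ Δ ∧ P = Q
  | f :: w, P, Q => ∃ R, 𝓛.Arrow Δ P f R ∧ Chain w R Q

/-- `S_f`, the set of all `x ∈ S` for which `x^f` is defined and lies in `S`. -/
def sf (f : L) : Set L := {x | x ∈ S ∧ x ∈ 𝓛.conjDom f ∧ 𝓛.conj x f ∈ S}

variable {𝓛 Δ S}

/-- Chains in the form in which they occur in the definition of a locality. -/
theorem chain_iff (w : List L) (P Q : Set L) : 𝓛.Chain Δ w P Q ↔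
    ∃ F : ℕ → Set L, F 0 = P ∧ F w.length = Q ∧ (∀ i ≤ w.length, F i ∈ Δ) ∧
      ∀ (i : ℕ) (hi : i < w.length),
        F i ⊆ 𝓛.conjDom w[i] ∧ 𝓛.conjSet (F i) w[i] = F (i + 1) := by
  induction w generalizing P with
  | nil =>
    constructor
    · rintro ⟨h, rfl⟩
      exact ⟨fun _ => P, rfl, rfl, fun _ _ => h, by simp⟩
    · rintro ⟨F, rfl, rfl, h, -⟩
      exact ⟨h 0 le_rfl, rfl⟩
  | cons f w ih =>
    constructor
    · rintro ⟨R, hR, hc⟩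
      obtain ⟨F, rfl, rfl, h1, h2⟩ := (ih R).1 hc
      refine ⟨fun i => Nat.casesOn i P F, rfl, rfl, ?_, ?_⟩
      · rintro (_ | i) hi
        · exact hR.src
        · exact h1 i (Nat.le_of_succ_le_succ hi)
      · rintro (_ | i) hi
        · exact ⟨hR.sub, hR.eq⟩
        · exact h2 i (Nat.lt_of_succ_lt_succ hi)
    · rintro ⟨F, rfl, rfl, h1, h2⟩
      refine ⟨F 1, ⟨h1 0 (Nat.zero_le _), h1 1 (Nat.succ_le_succ (Nat.zero_le _)),
        (h2 0 (Nat.succ_pos _)).1, (h2 0 (Nat.succ_pos _)).2⟩, (ih _).2 ?_⟩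
      exact ⟨fun i => F (i + 1), rfl, rfl, fun i hi => h1 (i + 1) (Nat.succ_le_succ hi),
        fun i hi => h2 (i + 1) (Nat.succ_lt_succ hi)⟩

theorem Chain.src {w : List L} {P Q : Set L} (h : 𝓛.Chain Δ w P Q) : P ∈ Δ := by
  cases w with
  | nil => exact h.1
  | cons f w => obtain ⟨R, hR, -⟩ := h; exact hR.src

theorem Arrow.unique {P Q Q' : Set L} {f : L} (h : 𝓛.Arrow Δ P f Q) (h' : 𝓛.Arrow Δ P f Q') :
    Q = Q' := h.eq.symm.trans h'.eq

theorem Arrow.conj_mem {P Q : Set L} {f x : L} (h : 𝓛.Arrow Δ P f Q) (hx : x ∈ P) :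
    𝓛.conj x f ∈ Q := h.eq ▸ Set.mem_image_of_mem _ hx

theorem Arrow.one {P : Set L} (hP : P ∈ Δ) : 𝓛.Arrow Δ P 𝓛.one P :=
  ⟨hP, hP, (𝓛.one_mem_normalizer P).1, (𝓛.one_mem_normalizer P).2⟩

/-- The arrows from an object to itself are the elements of its normalizer. -/
theorem arrow_self_iff {P : Set L} (hP : P ∈ Δ) {g : L} :
    𝓛.Arrow Δ P g P ↔ g ∈ 𝓛.normalizer P :=
  ⟨fun h => ⟨h.sub, h.eq⟩, fun h => ⟨hP, hP, h.1, h.2⟩⟩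

theorem Arrow.inv {P Q : Set L} {f : L} (h : 𝓛.Arrow Δ P f Q) :
    𝓛.Arrow Δ Q (𝓛.inv f) P := by
  refine ⟨h.tgt, h.src, ?_, ?_⟩
  · intro y hy
    rw [← h.eq] at hy
    obtain ⟨x, hx, rfl⟩ := hy
    exact (𝓛.inv_conj (h.sub hx)).1
  · rw [← h.eq, conjSet, conjSet, Set.image_image]
    exact (Set.image_congr fun x hx => (𝓛.inv_conj (h.sub hx)).2).trans (Set.image_id' P)

namespace IsLocality

variable {p : ℕ}

theorem mem_D_iff_chain (hL : 𝓛.IsLocality p Δ S) {w : List L} :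
    w ∈ 𝓛.D ↔ ∃ P Q, 𝓛.Chain Δ w P Q := by
  rw [hL.mem_D_iff]
  constructor
  · rintro ⟨F, h1, h2⟩
    exact ⟨F 0, F w.length, (chain_iff _ _ _).2 ⟨F, rfl, rfl, h1, h2⟩⟩
  · rintro ⟨P, Q, h⟩
    obtain ⟨F, -, -, h1, h2⟩ := (chain_iff _ _ _).1 h
    exact ⟨F, h1, h2⟩

theorem exists_arrow (hL : 𝓛.IsLocality p Δ S) (f : L) : ∃ P Q, 𝓛.Arrow Δ P f Q := by
  obtain ⟨P, Q, R, h, -⟩ := hL.mem_D_iff_chain.1 (𝓛.single_mem f)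
  exact ⟨P, R, h⟩

theorem mem_D_pair (hL : 𝓛.IsLocality p Δ S) {P Q R : Set L} {f g : L} (hf : 𝓛.Arrow Δ P f Q)
    (hg : 𝓛.Arrow Δ Q g R) : [f, g] ∈ 𝓛.D :=
  hL.mem_D_iff_chain.2 ⟨P, R, Q, hf, R, hg, hg.tgt, rfl⟩

theorem mem_D_triple (hL : 𝓛.IsLocality p Δ S) {P Q R T : Set L} {f g h : L}
    (hf : 𝓛.Arrow Δ P f Q) (hg : 𝓛.Arrow Δ Q g R) (hh : 𝓛.Arrow Δ R h T) : [f, g, h] ∈ 𝓛.D :=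
  hL.mem_D_iff_chain.2 ⟨P, T, Q, hf, R, hg, T, hh, hh.tgt, rfl⟩

theorem mul_assoc (hL : 𝓛.IsLocality p Δ S) {P Q R T : Set L} {f g h : L}
    (hf : 𝓛.Arrow Δ P f Q) (hg : 𝓛.Arrow Δ Q g R) (hh : 𝓛.Arrow Δ R h T) :
    𝓛.mul (𝓛.mul f g) h = 𝓛.mul f (𝓛.mul g h) :=
  𝓛.mul_assoc_of_mem (hL.mem_D_triple hf hg hh)

theorem inv_mul_cancel_left (hL : 𝓛.IsLocality p Δ S) {P Q R : Set L} {f g : L}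
    (hf : 𝓛.Arrow Δ P f Q) (hg : 𝓛.Arrow Δ Q g R) : 𝓛.mul (𝓛.inv f) (𝓛.mul f g) = g := by
  rw [← hL.mul_assoc hf.inv hf hg, inv_mul, one_mul']

theorem mul_inv_cancel_left (hL : 𝓛.IsLocality p Δ S) {P Q R : Set L} {f g : L}
    (hf : 𝓛.Arrow Δ P f Q) (hg : 𝓛.Arrow Δ P g R) : 𝓛.mul f (𝓛.mul (𝓛.inv f) g) = g := by
  rw [← hL.mul_assoc hf hf.inv hg, mul_inv, one_mul']

theorem mul_inv_cancel_right (hL : 𝓛.IsLocality p Δ S) {P Q R : Set L} {f g : L}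
    (hf : 𝓛.Arrow Δ P f Q) (hg : 𝓛.Arrow Δ Q g R) : 𝓛.mul (𝓛.mul f g) (𝓛.inv g) = f := by
  rw [hL.mul_assoc hf hg hg.inv, mul_inv, mul_one']

theorem mem_conjDom (hL : 𝓛.IsLocality p Δ S) {P P' Q Q' : Set L} {f x : L}
    (hx : 𝓛.Arrow Δ P x P') (hf : 𝓛.Arrow Δ P f Q) (hf' : 𝓛.Arrow Δ P' f Q') :
    x ∈ 𝓛.conjDom f :=
  hL.mem_D_triple hf.inv hx hf'

end IsLocality

variable {p : ℕ}

theorem Arrow.comp (hL : 𝓛.IsLocality p Δ S) {P Q R : Set L} {f g : L} (hf : 𝓛.Arrow Δ P f Q)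
    (hg : 𝓛.Arrow Δ Q g R) : 𝓛.Arrow Δ P (𝓛.mul f g) R := by
  have hinv : 𝓛.mul (𝓛.inv g) (𝓛.inv f) = 𝓛.inv (𝓛.mul f g) := by
    have d : [𝓛.inv g, 𝓛.inv f, f, g] ∈ 𝓛.D :=
      hL.mem_D_iff_chain.2 ⟨R, R, Q, hg.inv, P, hf.inv, Q, hf, R, hg, hg.tgt, rfl⟩
    have d1 := 𝓛.collapse_mem [] [𝓛.inv g, 𝓛.inv f] [f, g] d
    have a1 := 𝓛.prod_collapse [] [𝓛.inv g, 𝓛.inv f] [f, g] d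
    have d2 := 𝓛.collapse_mem [𝓛.prod [𝓛.inv g, 𝓛.inv f]] [f, g] [] (by simpa using d1)
    have a2 := 𝓛.prod_collapse [𝓛.prod [𝓛.inv g, 𝓛.inv f]] [f, g] [] (by simpa using d1)
    have a3 := 𝓛.prod_inv_append [f, g] (hL.mem_D_pair hf hg)
    simp only [List.nil_append, List.append_nil, List.cons_append, List.map_cons, List.map_nil,
      List.reverse_cons, List.reverse_nil] at d2 a1 a2 a3
    exact 𝓛.inv_eq_of_prod_eq_one d2 (a2.symm.trans (a1.symm.trans a3))
  have key : ∀ x ∈ P, x ∈ 𝓛.conjDom (𝓛.mul f g) ∧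
      𝓛.conj x (𝓛.mul f g) = 𝓛.conj (𝓛.conj x f) g := by
    intro x hx
    have hx' := (arrow_self_iff hf.src).2 (hL.subset_normalizer hf.src hx)
    have d : [𝓛.inv g, 𝓛.inv f, x, f, g] ∈ 𝓛.D :=
      hL.mem_D_iff_chain.2 ⟨R, R, Q, hg.inv, P, hf.inv, P, hx', Q, hf, R, hg, hg.tgt, rfl⟩
    have d1 := 𝓛.collapse_mem [] [𝓛.inv g, 𝓛.inv f] [x, f, g] d
    have a1 := 𝓛.prod_collapse [] [𝓛.inv g, 𝓛.inv f] [x, f, g] d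
    have d2 := 𝓛.collapse_mem [𝓛.prod [𝓛.inv g, 𝓛.inv f], x] [f, g] [] (by simpa using d1)
    have a2 := 𝓛.prod_collapse [𝓛.prod [𝓛.inv g, 𝓛.inv f], x] [f, g] [] (by simpa using d1)
    have a3 := 𝓛.prod_collapse [𝓛.inv g] [𝓛.inv f, x, f] [g] d
    simp only [mul] at hinv ⊢
    simp only [List.nil_append, List.append_nil, List.cons_append, hinv] at d2 a1 a2 a3
    refine ⟨d2, ?_⟩
    simp only [conj]
    rw [← a2, ← a1, a3]
  refine ⟨hf.src, hg.tgt, fun x hx => (key x hx).1, ?_⟩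
  rw [← hg.eq, ← hf.eq, conjSet, conjSet, conjSet, Set.image_image]
  exact Set.image_congr fun x hx => (key x hx).2

namespace IsLocality

theorem arrow_prod (hL : 𝓛.IsLocality p Δ S) {w : List L} {P Q : Set L}
    (h : 𝓛.Chain Δ w P Q) : 𝓛.Arrow Δ P (𝓛.prod w) Q := by
  induction w generalizing P with
  | nil =>
    obtain ⟨hP, rfl⟩ := h
    exact Arrow.one hP
  | cons f w ih =>
    have hD := hL.mem_D_iff_chain.2 ⟨P, Q, h⟩
    obtain ⟨R, hR, hc⟩ := h
    rw [𝓛.prod_cons hD]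
    exact hR.comp hL (ih hc)

theorem mul_conj (hL : 𝓛.IsLocality p Δ S) {P P' Q Q' : Set L} {f x : L}
    (hx : 𝓛.Arrow Δ P x P') (hf : 𝓛.Arrow Δ P f Q) (hf' : 𝓛.Arrow Δ P' f Q') :
    𝓛.mul f (𝓛.conj x f) = 𝓛.mul x f := by
  rw [𝓛.conj_eq_mul (hL.mem_conjDom hx hf hf'), hL.mul_inv_cancel_left hf (hx.comp hL hf')]
  
theorem arrow_conj (hL : 𝓛.IsLocality p Δ S) {P P' Q Q' : Set L} {f x : L}
    (hx : 𝓛.Arrow Δ P x P') (hf : 𝓛.Arrow Δ P f Q) (hf' : 𝓛.Arrow Δ P' f Q') :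
    𝓛.Arrow Δ Q (𝓛.conj x f) Q' := by
  rw [𝓛.conj_eq_mul (hL.mem_conjDom hx hf hf')]
  exact hf.inv.comp hL (hx.comp hL hf')

/-- `x^f` is determined by `f x^f = x f`. -/
theorem conj_eq_of_mul_eq (hL : 𝓛.IsLocality p Δ S) {P P' Q Q' : Set L} {f x c : L}
    (hx : 𝓛.Arrow Δ P x P') (hf : 𝓛.Arrow Δ P f Q) (hf' : 𝓛.Arrow Δ P' f Q')
    (hc : 𝓛.Arrow Δ Q c Q') (h : 𝓛.mul f c = 𝓛.mul x f) : 𝓛.conj x f = c := by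
  rw [𝓛.conj_eq_mul (hL.mem_conjDom hx hf hf'), ← h, hL.inv_mul_cancel_left hf hc]

theorem conj_conj (hL : 𝓛.IsLocality p Δ S) {P P' Q Q' R R' : Set L} {f g x : L}
    (hx : 𝓛.Arrow Δ P x P') (hf : 𝓛.Arrow Δ P f Q) (hf' : 𝓛.Arrow Δ P' f Q')
    (hg : 𝓛.Arrow Δ Q g R) (hg' : 𝓛.Arrow Δ Q' g R') :
    𝓛.conj (𝓛.conj x f) g = 𝓛.conj x (𝓛.mul f g) := by
  have hc := hL.arrow_conj hx hf hf'
  refine (hL.conj_eq_of_mul_eq hx (hf.comp hL hg) (hf'.comp hL hg')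
    (hL.arrow_conj hc hg hg') ?_).symm
  rw [hL.mul_assoc hf hg (hL.arrow_conj hc hg hg'), hL.mul_conj hc hg hg',
    ← hL.mul_assoc hf hc hg', hL.mul_conj hx hf hf', hL.mul_assoc hx hf' hg']

theorem conj_mul (hL : 𝓛.IsLocality p Δ S) {P P' P'' Q Q' Q'' : Set L} {f x y : L}
    (hx : 𝓛.Arrow Δ P x P') (hy : 𝓛.Arrow Δ P' y P'') (hf : 𝓛.Arrow Δ P f Q)
    (hf' : 𝓛.Arrow Δ P' f Q') (hf'' : 𝓛.Arrow Δ P'' f Q'') :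
    𝓛.conj (𝓛.mul x y) f = 𝓛.mul (𝓛.conj x f) (𝓛.conj y f) := by
  have hxf := hL.arrow_conj hx hf hf'
  have hyf := hL.arrow_conj hy hf' hf''
  refine hL.conj_eq_of_mul_eq (hx.comp hL hy) hf hf'' (hxf.comp hL hyf) ?_
  rw [← hL.mul_assoc hf hxf hyf, hL.mul_conj hx hf hf', hL.mul_assoc hx hf' hyf,
    hL.mul_conj hy hf' hf'', hL.mul_assoc hx hy hf'']

theorem conj_inv (hL : 𝓛.IsLocality p Δ S) {P P' Q Q' : Set L} {f x : L}
    (hx : 𝓛.Arrow Δ P x P') (hf : 𝓛.Arrow Δ P f Q) (hf' : 𝓛.Arrow Δ P' f Q') :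
    𝓛.conj (𝓛.inv x) f = 𝓛.inv (𝓛.conj x f) := by
  have hxf := hL.arrow_conj hx hf hf'
  refine hL.conj_eq_of_mul_eq hx.inv hf' hf hxf.inv ?_
  have e := hL.inv_mul_cancel_left hx hf'
  rw [← hL.mul_conj hx hf hf'] at e
  have e' := hL.mul_assoc hx.inv (hf.comp hL hxf) hxf.inv
  rw [e, hL.mul_inv_cancel_right hf hxf] at e'
  exact e'

theorem S_mem (hL : 𝓛.IsLocality p Δ S) : S ∈ Δ := by
  obtain ⟨P, hP⟩ := hL.nonempty
  exact hL.over_mem P hP S hL.isSubgroup subset_rfl (hL.subgroup_of_mem P hP).2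

theorem subset_S (hL : 𝓛.IsLocality p Δ S) {P : Set L} (hP : P ∈ Δ) : P ⊆ S :=
  (hL.subgroup_of_mem P hP).2

theorem arrow_of_mem (hL : 𝓛.IsLocality p Δ S) {P : Set L} (hP : P ∈ Δ) {x : L} (hx : x ∈ P) :
    𝓛.Arrow Δ P x P :=
  (arrow_self_iff hP).2 (hL.subset_normalizer hP hx)

theorem sf_subset (f : L) : 𝓛.sf S f ⊆ S := fun _ hx => hx.1

theorem subset_sf (hL : 𝓛.IsLocality p Δ S) {P Q : Set L} {f : L} (h : 𝓛.Arrow Δ P f Q) :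
    P ⊆ 𝓛.sf S f := fun _ hx =>
  ⟨hL.subset_S h.src hx, h.sub hx, hL.subset_S h.tgt (h.conj_mem hx)⟩

theorem arrow_of_subset_sf (hL : 𝓛.IsLocality p Δ S) {P : Set L} (hP : P ∈ Δ) {f : L}
    (h : P ⊆ 𝓛.sf S f) : 𝓛.Arrow Δ P f (𝓛.conjSet P f) := by
  have hsub : P ⊆ 𝓛.conjDom f := fun x hx => (h hx).2.1
  refine ⟨hP, hL.conj_mem P hP f hsub ?_, hsub, rfl⟩
  rintro _ ⟨x, hx, rfl⟩
  exact (h hx).2.2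

theorem sf_eq_of_mem (hL : 𝓛.IsLocality p Δ S) {x : L} (hx : x ∈ S) : 𝓛.sf S x = S :=
  (sf_subset x).antisymm (hL.subset_sf (hL.arrow_of_mem hL.S_mem hx))

theorem arrow_restrict (hL : 𝓛.IsLocality p Δ S) {P Q R : Set L} {f : L} (h : 𝓛.Arrow Δ P f Q)
    (hR : R ∈ Δ) (hRP : R ⊆ P) : 𝓛.Arrow Δ R f (𝓛.conjSet R f) :=
  hL.arrow_of_subset_sf hR (hRP.trans (hL.subset_sf h))

theorem arrow_S (hL : 𝓛.IsLocality p Δ S) {P : Set L} (hP : P ∈ Δ) {x : L} (hx : x ∈ S) :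
    𝓛.Arrow Δ P x (𝓛.conjSet P x) :=
  hL.arrow_of_subset_sf hP ((hL.sf_eq_of_mem hx).symm ▸ hL.subset_S hP)

/-- If `f` conjugates the object `P` into `S`, then it does so with `P^x` for `x ∈ S_f`, as
`f = x⁻¹ f x^f`. -/
theorem arrow_conjSet_of_mem_sf (hL : 𝓛.IsLocality p Δ S) {P Q : Set L} {f x : L}
    (hx : x ∈ 𝓛.sf S f) (h : 𝓛.Arrow Δ P f Q) :
    𝓛.Arrow Δ (𝓛.conjSet P x) f (𝓛.conjSet Q (𝓛.conj x f)) := by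
  obtain ⟨hxS, hxf, hs⟩ := hx
  obtain ⟨R0, R4, R1, h1, R2, h2, R3, h3, -⟩ := hL.mem_D_iff_chain.1 hxf
  have h1' : 𝓛.Arrow Δ R1 f R0 := by simpa [𝓛.inv_inv] using h1.inv
  have e : 𝓛.mul (𝓛.inv x) (𝓛.mul f (𝓛.conj x f)) = f := by
    rw [hL.mul_conj h2 h1' h3, hL.inv_mul_cancel_left h2 h3]
  have := (hL.arrow_S h.src hxS).inv.comp hL (h.comp hL (hL.arrow_S h.tgt hs))
  rwa [e] at this

/-- `S_f` is an object. For closure under products, given `x, y ∈ S_f` and an object `P` with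
`P^f ≤ S`, the element `f` also conjugates `P^x` and `P^{xy}` into `S`, so that `(xy)^f = x^f y^f`
can be computed along these objects. -/
theorem sf_mem (hL : 𝓛.IsLocality p Δ S) (f : L) : 𝓛.sf S f ∈ Δ := by
  obtain ⟨P, Q, h⟩ := hL.exists_arrow f
  have hS := hL.isSubgroup
  refine hL.over_mem P h.src _ (hS.of_subset (sf_subset f) ?_ ?_ ?_) (sf_subset f) (hL.subset_sf h)
  · exact hL.subset_sf h (hL.subgroup_of_mem P h.src).1.one_mem
  · intro x hx
    have hPx := hL.arrow_S h.src hx.1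
    have hf := hL.arrow_conjSet_of_mem_sf hx h
    refine ⟨hS.inv_mem hx.1, hL.mem_conjDom hPx.inv hf h, ?_⟩
    rw [hL.conj_inv hPx h hf]
    exact hS.inv_mem hx.2.2
  · intro x hx y hy
    have hPx := hL.arrow_S h.src hx.1
    have hf := hL.arrow_conjSet_of_mem_sf hx h
    have hPy := hL.arrow_S hPx.tgt hy.1
    have hf' := hL.arrow_conjSet_of_mem_sf hy hf
    refine ⟨hS.mul_mem hx.1 hy.1, hL.mem_conjDom (hPx.comp hL hPy) h hf', ?_⟩
    rw [hL.conj_mul hPx hPy h hf hf']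
    exact hS.mul_mem hx.2.2 hy.2.2

theorem isSubgroup_of_mem (hL : 𝓛.IsLocality p Δ S) {P : Set L} (hP : P ∈ Δ) : 𝓛.IsSubgroup P :=
  (hL.subgroup_of_mem P hP).1

theorem isPGroup_of_mem (hL : 𝓛.IsLocality p Δ S) {P : Set L} (hP : P ∈ Δ) :
    IsPGroup p (hL.isSubgroup_of_mem hP).Elems :=
  IsSubgroup.isPGroup_of_subset _ hL.isSubgroup (hL.subset_S hP) hL.isPSubgroup.2.2

theorem inter_mem (hL : 𝓛.IsLocality p Δ S) {P Q R : Set L} (hP : P ∈ Δ) (hQ : Q ∈ Δ)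
    (hR : 𝓛.IsSubgroup R) (hPQ : P ⊆ Q) (hPR : P ⊆ R) : Q ∩ R ∈ Δ :=
  hL.over_mem P hP _ ((hL.isSubgroup_of_mem hQ).inter hR)
    (Set.inter_subset_left.trans (hL.subset_S hQ)) (Set.subset_inter hPQ hPR)

theorem inter_normalizer_mem (hL : 𝓛.IsLocality p Δ S) {P Q : Set L} (hP : P ∈ Δ) (hQ : Q ∈ Δ)
    (hPQ : P ⊆ Q) : Q ∩ 𝓛.normalizer P ∈ Δ :=
  hL.inter_mem hP hQ (hL.isSubgroup_normalizer hP) hPQ (hL.subset_normalizer hP)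

/-- As `L` is finite, `P^x ⊆ P` implies `P^x = P`. -/
theorem mem_normalizer_of_conj_mem (hL : 𝓛.IsLocality p Δ S) {P : Set L} {x : L}
    (h : ∀ y ∈ P, y ∈ 𝓛.conjDom x ∧ 𝓛.conj y x ∈ P) : x ∈ 𝓛.normalizer P := by
  have := hL.finite
  refine ⟨fun y hy => (h y hy).1, ?_⟩
  have hsub : 𝓛.conjSet P x ⊆ P := by
    rintro _ ⟨y, hy, rfl⟩
    exact (h y hy).2
  refine Set.eq_of_subset_of_ncard_le hsub ?_ P.toFinite
  refine (Set.InjOn.ncard_image ?_).ge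
  intro y hy z hz hyz
  rw [← (𝓛.inv_conj (h y hy).1).2, ← (𝓛.inv_conj (h z hz).1).2]
  exact congrArg (fun t => 𝓛.conj t (𝓛.inv x)) hyz

/-- Normalizers grow: an object `P < Q` is properly contained in `N_Q(P)`. -/
theorem ssubset_inter_normalizer (hL : 𝓛.IsLocality p Δ S) (hp : p.Prime) {P Q : Set L}
    (hP : P ∈ Δ) (hQ : Q ∈ Δ) (hPQ : P ⊂ Q) : P ⊂ Q ∩ 𝓛.normalizer P := by
  have := Fact.mk hp
  have := hL.finite
  refine ⟨Set.subset_inter hPQ.1 (hL.subset_normalizer hP), fun hle => ?_⟩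
  have hQs := hL.isSubgroup_of_mem hQ
  have hPs := hL.isSubgroup_of_mem hP
  have := (hL.isPGroup_of_mem hQ).isNilpotent
  have hlt : hPs.restrict hQs < ⊤ := by
    rw [lt_top_iff_ne_top]
    intro h
    refine hPQ.2 fun x hx => ?_
    have : hQs.mk x hx ∈ hPs.restrict hQs := h ▸ Subgroup.mem_top _
    exact this
  obtain ⟨n, hn, hnP⟩ := SetLike.exists_of_lt (Group.normalizerCondition_of_isNilpotent _ hlt)
  refine hnP (hle ⟨n.mem, hL.mem_normalizer_of_conj_mem fun y hy => ?_⟩)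
  refine ⟨hQs.mem_conjDom (hPQ.1 hy) n.mem, ?_⟩
  have h := (Subgroup.mem_normalizer_iff''.1 hn (hQs.mk y (hPQ.1 hy))).1 hy
  rw [IsSubgroup.mem_restrict, IsSubgroup.Elems.val_conj] at h
  exact h

/-- Induction from an object `Q` down to its subobjects, through `N_Q(P)`. -/
theorem climb (hL : 𝓛.IsLocality p Δ S) (hp : p.Prime) {Q : Set L} (hQ : Q ∈ Δ)
    {motive : Set L → Prop} (base : motive Q)
    (step : ∀ P ∈ Δ, P ⊂ Q → motive (Q ∩ 𝓛.normalizer P) → motive P) :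
    ∀ P ∈ Δ, P ⊆ Q → motive P := by
  have := hL.finite
  intro P
  induction P using WellFoundedGT.induction with
  | ind P ih =>
    intro hP hPQ
    rcases hPQ.eq_or_ssubset with rfl | hlt
    · exact base
    · exact step P hP hlt (ih _ (hL.ssubset_inter_normalizer hp hP hQ hlt)
        (hL.inter_normalizer_mem hP hQ hPQ) Set.inter_subset_left)

/-- Conjugation by `f` is an isomorphism `N_L(P) ≃ N_L(P^f)`. -/
def conjEquiv (hL : 𝓛.IsLocality p Δ S) {P Q : Set L} (hP : P ∈ Δ) (hQ : Q ∈ Δ) {f : L}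
    (h : 𝓛.Arrow Δ P f Q) : hL.NormalizerGroup hP ≃* hL.NormalizerGroup hQ where
  toFun x := (hL.isSubgroup_normalizer hQ).mk (𝓛.conj x.val f)
    ((arrow_self_iff hQ).1 (hL.arrow_conj ((arrow_self_iff hP).2 x.mem) h h))
  invFun y := (hL.isSubgroup_normalizer hP).mk (𝓛.conj y.val (𝓛.inv f))
    ((arrow_self_iff hP).1 (hL.arrow_conj ((arrow_self_iff hQ).2 y.mem) h.inv h.inv))
  left_inv x := IsSubgroup.Elems.ext
    (𝓛.inv_conj (hL.mem_conjDom ((arrow_self_iff hP).2 x.mem) h h)).2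
  right_inv y := IsSubgroup.Elems.ext <| by
    have := (𝓛.inv_conj (hL.mem_conjDom ((arrow_self_iff hQ).2 y.mem) h.inv h.inv)).2
    rwa [𝓛.inv_inv] at this
  map_mul' x y := IsSubgroup.Elems.ext
    (hL.conj_mul ((arrow_self_iff hP).2 x.mem) ((arrow_self_iff hP).2 y.mem) h h h)

end IsLocality

end Arrows

end PartialGroup

/-! ### The subgroups `O_{p'}(N_L(P))` -/

namespace PartialGroup

variable {L : Type u} {𝓛 : PartialGroup L} {Δ : Set (Set L)} {S : Set L} {p : ℕ}

namespace IsLocality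

/-- All the groups `N_L(P)`, for objects `P`, are almost of characteristic `p`. -/
def IsObjectiveAlmostCharP (hL : 𝓛.IsLocality p Δ S) : Prop :=
  ∀ (P : Set L) (hP : P ∈ Δ), IsAlmostCharP p (hL.NormalizerGroup hP)

/-- `Θ(P) = O_{p'}(N_L(P))` as a subset of `L`; it is empty if `P` is not an object. -/
def theta (hL : 𝓛.IsLocality p Δ S) (P : Set L) : Set L :=
  {x | ∃ hP : P ∈ Δ, ∃ y ∈ OpPrime p (hL.NormalizerGroup hP), y.val = x}

theorem theta_subset_Theta (hL : 𝓛.IsLocality p Δ S) (P : Set L) : hL.theta P ⊆ hL.Theta :=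
  fun _ ⟨hP, y, hy, h⟩ => ⟨P, hP, y, hy, h⟩

theorem mem_Theta_iff (hL : 𝓛.IsLocality p Δ S) {x : L} :
    x ∈ hL.Theta ↔ ∃ P ∈ Δ, x ∈ hL.theta P :=
  ⟨fun ⟨P, hP, y, hy, h⟩ => ⟨P, hP, hP, y, hy, h⟩, fun ⟨P, _, h⟩ => hL.theta_subset_Theta P h⟩

theorem mem_theta (hL : 𝓛.IsLocality p Δ S) {P : Set L} (hP : P ∈ Δ)
    {x : hL.NormalizerGroup hP} : x.val ∈ hL.theta P ↔ x ∈ OpPrime p (hL.NormalizerGroup hP) := by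
  constructor
  · rintro ⟨_, y, hy, h⟩
    rwa [← IsSubgroup.Elems.ext h]
  · intro h
    exact ⟨hP, x, h, rfl⟩

theorem theta_subset_normalizer (hL : 𝓛.IsLocality p Δ S) (P : Set L) :
    hL.theta P ⊆ 𝓛.normalizer P := by
  rintro _ ⟨hP, y, hy, rfl⟩
  exact y.mem

theorem theta_isSubgroup (hL : 𝓛.IsLocality p Δ S) {P : Set L} (hP : P ∈ Δ) :
    𝓛.IsSubgroup (hL.theta P) := by
  have := IsSubgroup.of_subgroup _ (OpPrime p (hL.NormalizerGroup hP))
  convert this using 1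
  ext x
  exact ⟨fun ⟨_, y, hy, h⟩ => ⟨y, hy, h⟩, fun ⟨y, hy, h⟩ => ⟨hP, y, hy, h⟩⟩

theorem arrow_theta (hL : 𝓛.IsLocality p Δ S) {P : Set L} (hP : P ∈ Δ) {n : L}
    (hn : n ∈ hL.theta P) : 𝓛.Arrow Δ P n P :=
  (arrow_self_iff hP).2 (hL.theta_subset_normalizer P hn)

theorem orderOf_coprime_of_mem_theta (hL : 𝓛.IsLocality p Δ S) {P H : Set L} {h : 𝓛.IsSubgroup H}
    {x : h.Elems} (hx : x.val ∈ hL.theta P) : (orderOf x).Coprime p := by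
  have := hL.finite
  obtain ⟨hP, y, hy, hxy⟩ := hx
  rw [← IsSubgroup.Elems.orderOf_congr hxy]
  exact orderOf_coprime_of_mem (OpPrime.card_coprime p _) hy

theorem isPGroup_restrict_S (hL : 𝓛.IsLocality p Δ S) {H : Set L} (h : 𝓛.IsSubgroup H) :
    IsPGroup p (hL.isSubgroup.restrict h) :=
  IsSubgroup.restrict_isPGroup _ _ hL.isPSubgroup.2.2

theorem eq_one_of_mem_theta_of_mem_S (hL : 𝓛.IsLocality p Δ S) {P : Set L} {x : L} (hx : x ∈ hL.theta P)
    (hxS : x ∈ S) : x = 𝓛.one := by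
  obtain ⟨hP, y, hy, rfl⟩ := hx
  have := (hL.isPGroup_restrict_S (hL.isSubgroup_normalizer hP)).eq_one_of_coprime
    (x := y) hxS (hL.orderOf_coprime_of_mem_theta ((hL.mem_theta hP).2 hy))
  rw [this]
  rfl

theorem conj_mem_theta (hL : 𝓛.IsLocality p Δ S) {P Q : Set L} {f n : L} (h : 𝓛.Arrow Δ P f Q)
    (hn : n ∈ hL.theta P) : 𝓛.conj n f ∈ hL.theta Q := by
  obtain ⟨hP, y, hy, rfl⟩ := hn
  exact ⟨h.tgt, _, OpPrime.map_le (hL.conjEquiv hP h.tgt h) hy, rfl⟩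

/-- If `x ∈ S ∩ N_L(P)` and `n ∈ Θ(P)` are such that `x^n` is again in `S`, then `x^n = x`: the
commutator of `x` and `n` lies in `S` and in the `p'`-group `Θ(P)`. -/
theorem conj_eq_of_mem_theta (hL : 𝓛.IsLocality p Δ S) {P : Set L} (hP : P ∈ Δ) {n x : L}
    (hn : n ∈ hL.theta P) (hx : x ∈ 𝓛.normalizer P) (hxS : x ∈ S) (hxn : 𝓛.conj x n ∈ S) :
    𝓛.conj x n = x := by
  obtain ⟨_, y, hy, rfl⟩ := hn
  let z := (hL.isSubgroup_normalizer hP).mk x hx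
  have h1 : z⁻¹ * (y⁻¹ * z * y) ∈ OpPrime p (hL.NormalizerGroup hP) := by
    have := (OpPrime p _).mul_mem
      ((OpPrime.normal p _).conj_mem _ ((OpPrime p _).inv_mem hy) z⁻¹) hy
    simpa [_root_.mul_assoc] using this
  have h2 : z⁻¹ * (y⁻¹ * z * y) ∈ hL.isSubgroup.restrict (hL.isSubgroup_normalizer hP) := by
    refine Subgroup.mul_mem _ (Subgroup.inv_mem _ hxS) ?_
    rw [IsSubgroup.mem_restrict, IsSubgroup.Elems.val_conj]
    exact hxn
  have h3 := (hL.isPGroup_restrict_S _).eq_one_of_coprime h2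
    (hL.orderOf_coprime_of_mem_theta ((hL.mem_theta hP).2 h1))
  rw [inv_mul_eq_one] at h3
  rw [← IsSubgroup.Elems.val_mk (h := hL.isSubgroup_normalizer hP) x hx,
    ← IsSubgroup.Elems.val_conj]
  exact congrArg _ h3.symm

/-- `Θ(P)` centralizes `P`. -/
theorem conj_eq_of_mem_theta_of_mem (hL : 𝓛.IsLocality p Δ S) {P : Set L} (hP : P ∈ Δ) {n x : L}
    (hn : n ∈ hL.theta P) (hx : x ∈ P) : 𝓛.conj x n = x :=
  hL.conj_eq_of_mem_theta hP hn (hL.subset_normalizer hP hx) (hL.subset_S hP hx)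
    (hL.subset_S hP ((hL.arrow_theta hP hn).conj_mem hx))

/-- `le_OpPrime_of_normal_in_normalizer`, for the subgroups `T`, `X` of `N_L(P)`. -/
theorem subset_theta (hL : 𝓛.IsLocality p Δ S) (hp : p.Prime)
    (hΔ : hL.IsObjectiveAlmostCharP) {P T X : Set L} (hP : P ∈ Δ) (hT : 𝓛.IsSubgroup T) (hTp : IsPGroup p hT.Elems)
    (hTP : T ⊆ 𝓛.normalizer P) (hX : 𝓛.IsSubgroup X) (hXP : X ⊆ 𝓛.normalizer P)
    (hXp : ∀ x : hX.Elems, (orderOf x).Coprime p) (hXT : X ⊆ 𝓛.normalizer T)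
    (hN : ∀ g ∈ 𝓛.normalizer P, g ∈ 𝓛.normalizer T → ∀ x ∈ X, 𝓛.conj x g ∈ X) :
    X ⊆ hL.theta P := by
  have := hL.finite
  have hG := hL.isSubgroup_normalizer hP
  have key : hX.restrict hG ≤ OpPrime p hG.Elems := by
    refine le_OpPrime_of_normal_in_normalizer hp (hΔ P hP) (T := hT.restrict hG)
      (hT.restrict_isPGroup hG hTp) ?_ ?_ ?_
    · intro x hx
      have e : orderOf x = orderOf (hX.mk x.val hx) := IsSubgroup.Elems.orderOf_congr rfl
      exact e ▸ hXp _
    · intro x hx t ht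
      rw [IsSubgroup.mem_restrict, IsSubgroup.Elems.val_conj]
      have h := (hXT hx).2
      exact h ▸ Set.mem_image_of_mem _ ht
    · intro g hg x hx
      rw [IsSubgroup.mem_restrict, IsSubgroup.Elems.val_conj]
      refine hN _ g.mem (hL.mem_normalizer_of_conj_mem fun t ht => ?_) _ hx
      refine ⟨hG.mem_conjDom (hTP ht) g.mem, ?_⟩
      have := hg (hG.mk t (hTP ht)) ht
      rwa [IsSubgroup.mem_restrict, IsSubgroup.Elems.val_conj] at this
  intro x hx
  exact ⟨hP, _, key (show hG.mk x (hXP hx) ∈ hX.restrict hG from hx), rfl⟩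

theorem mem_normalizer_of_mem_theta (hL : 𝓛.IsLocality p Δ S) {P Q : Set L} (hQ : Q ∈ Δ)
    (hPQ : P ⊆ Q) {n : L} (hn : n ∈ hL.theta Q) : n ∈ 𝓛.normalizer P :=
  hL.mem_normalizer_of_conj_mem fun _ hy =>
    ⟨(hL.arrow_theta hQ hn).sub (hPQ hy), (hL.conj_eq_of_mem_theta_of_mem hQ hn (hPQ hy)).symm ▸ hy⟩

/-- The balance property for `P` normal in `Q`, by `subset_theta` in `N_L(P)` and in `N_L(Q)`:
`Θ(Q)` is normal in `N_L(P) ∩ N_L(Q)` because it centralizes `P ≤ Q`. -/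
theorem theta_eq_of_subset_normalizer (hL : 𝓛.IsLocality p Δ S) (hp : p.Prime)
    (hΔ : hL.IsObjectiveAlmostCharP) {P Q : Set L} (hP : P ∈ Δ) (hQ : Q ∈ Δ) (hPQ : P ⊆ Q) (hQP : Q ⊆ 𝓛.normalizer P) :
    hL.theta Q = hL.theta P ∩ 𝓛.normalizer Q := by
  have hQP' : hL.theta Q ⊆ 𝓛.normalizer P := fun _ => hL.mem_normalizer_of_mem_theta hQ hPQ
  refine Set.Subset.antisymm (Set.subset_inter ?_ (hL.theta_subset_normalizer Q)) ?_
  · refine hL.subset_theta hp hΔ hP (hL.isSubgroup_of_mem hQ) (hL.isPGroup_of_mem hQ) hQP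
      (hL.theta_isSubgroup hQ) hQP' (fun x => hL.orderOf_coprime_of_mem_theta x.mem)
      (hL.theta_subset_normalizer Q) ?_
    intro g _ hg x hx
    exact hL.conj_mem_theta ((arrow_self_iff hQ).2 hg) hx
  · refine hL.subset_theta hp hΔ hQ (hL.isSubgroup_of_mem hP) (hL.isPGroup_of_mem hP)
      (hPQ.trans (hL.subset_normalizer hQ))
      ((hL.theta_isSubgroup hP).inter (hL.isSubgroup_normalizer hQ)) Set.inter_subset_right
      (fun x => hL.orderOf_coprime_of_mem_theta x.mem.1)
      (Set.inter_subset_left.trans (hL.theta_subset_normalizer P)) ?_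
    intro g hgQ hgP x hx
    exact ⟨hL.conj_mem_theta ((arrow_self_iff hP).2 hgP) hx.1,
      (hL.isSubgroup_normalizer hQ).conj_mem hx.2 hgQ⟩

/-- The balance property: `Θ(Q) = Θ(P) ∩ N_L(Q)` for objects `P ≤ Q`. -/
theorem theta_eq (hL : 𝓛.IsLocality p Δ S) (hp : p.Prime)
    (hΔ : hL.IsObjectiveAlmostCharP) {P Q : Set L} (hP : P ∈ Δ) (hQ : Q ∈ Δ) (hPQ : P ⊆ Q) :
    hL.theta Q = hL.theta P ∩ 𝓛.normalizer Q := by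
  revert P
  suffices h : ∀ P ∈ Δ, P ⊆ Q → hL.theta Q = hL.theta P ∩ 𝓛.normalizer Q from
    fun {P} hP hPQ => h P hP hPQ
  refine hL.climb hp hQ (Set.inter_eq_left.2 (hL.theta_subset_normalizer Q)).symm ?_
  intro P hP hPQ ih
  rw [ih, hL.theta_eq_of_subset_normalizer hp hΔ hP (hL.inter_normalizer_mem hP hQ hPQ.1)
    (Set.subset_inter hPQ.1 (hL.subset_normalizer hP)) Set.inter_subset_right]
  ext x
  refine ⟨fun h => ⟨h.1.1, h.2⟩, fun h => ⟨⟨h.1, hL.mem_normalizer_of_conj_mem ?_⟩, h.2⟩⟩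
  intro y hy
  have hxP := hL.theta_subset_normalizer P h.1
  exact ⟨h.2.1 hy.1, h.2.2 ▸ Set.mem_image_of_mem _ hy.1,
    (hL.isSubgroup_normalizer hP).conj_mem hy.2 hxP⟩

theorem theta_antitone (hL : 𝓛.IsLocality p Δ S) (hp : p.Prime)
    (hΔ : hL.IsObjectiveAlmostCharP) {P Q : Set L} (hP : P ∈ Δ) (hQ : Q ∈ Δ) (hPQ : P ⊆ Q) : hL.theta Q ⊆ hL.theta P := by
  rw [hL.theta_eq hp hΔ hP hQ hPQ]
  exact Set.inter_subset_left

/-! ### Congruence modulo `Θ(P)` -/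

/-- `f` and `g` both conjugate the object `P` to another object, and `g ∈ Θ(P) f`. -/
def Rel (hL : 𝓛.IsLocality p Δ S) (P : Set L) (f g : L) : Prop :=
  ∃ Q, 𝓛.Arrow Δ P f Q ∧ ∃ n ∈ hL.theta P, g = 𝓛.mul n f

namespace Rel

variable {hL : 𝓛.IsLocality p Δ S} {P Q R : Set L} {f g h : L}

theorem src (hr : hL.Rel P f g) : P ∈ Δ := by
  obtain ⟨Q, hQ, -⟩ := hr
  exact hQ.src

theorem arrow (hr : hL.Rel P f g) (hf : 𝓛.Arrow Δ P f Q) : 𝓛.Arrow Δ P g Q := by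
  obtain ⟨Q', hQ, n, hn, rfl⟩ := hr
  exact (hL.arrow_theta hf.src hn).comp hL hf

theorem of_arrow (hf : 𝓛.Arrow Δ P f Q) : hL.Rel P f f :=
  ⟨Q, hf, 𝓛.one, (hL.theta_isSubgroup hf.src).one_mem, (𝓛.one_mul' f).symm⟩

theorem symm (hr : hL.Rel P f g) : hL.Rel P g f := by
  have hr' := hr
  obtain ⟨Q, hQ, n, hn, rfl⟩ := hr'
  refine ⟨Q, hr.arrow hQ, 𝓛.inv n, (hL.theta_isSubgroup hQ.src).inv_mem hn, ?_⟩
  rw [hL.inv_mul_cancel_left (hL.arrow_theta hQ.src hn) hQ]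

theorem trans (hr : hL.Rel P f g) (hr' : hL.Rel P g h) : hL.Rel P f h := by
  obtain ⟨Q, hQ, n, hn, rfl⟩ := hr
  obtain ⟨Q', hQ', m, hm, rfl⟩ := hr'
  have hP := hQ.src
  exact ⟨Q, hQ, 𝓛.mul m n, (hL.theta_isSubgroup hP).mul_mem hm hn,
    (hL.mul_assoc (hL.arrow_theta hP hm) (hL.arrow_theta hP hn) hQ).symm⟩

theorem subset_left (hr : hL.Rel P f g) : P ⊆ 𝓛.sf S f := by
  obtain ⟨Q, hQ, -⟩ := hr
  exact hL.subset_sf hQ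

theorem subset_right (hr : hL.Rel P f g) : P ⊆ 𝓛.sf S g := hr.symm.subset_left

theorem mul_right (hr : hL.Rel P f g) (hf : 𝓛.Arrow Δ P f Q) (hh : 𝓛.Arrow Δ Q h R) :
    hL.Rel P (𝓛.mul f h) (𝓛.mul g h) := by
  obtain ⟨Q', -, n, hn, rfl⟩ := hr
  exact ⟨R, hf.comp hL hh, n, hn, hL.mul_assoc (hL.arrow_theta hf.src hn) hf hh⟩

theorem mul_left (hr : hL.Rel P f g) (hh : 𝓛.Arrow Δ R h P) :
    hL.Rel R (𝓛.mul h f) (𝓛.mul h g) := by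
  obtain ⟨Q, hf, n, hn, rfl⟩ := hr
  have hnP := hL.arrow_theta hh.tgt hn
  have hc := hL.conj_mem_theta hh.inv hn
  refine ⟨Q, hh.comp hL hf, _, hc, ?_⟩
  have hcR := hL.arrow_theta hh.src hc
  have e : 𝓛.mul (𝓛.conj n (𝓛.inv h)) h = 𝓛.mul h n := by
    rw [𝓛.conj_eq_mul (hL.mem_conjDom hnP hh.inv hh.inv), 𝓛.inv_inv,
      hL.mul_assoc hh (hnP.comp hL hh.inv) hh, hL.mul_assoc hnP hh.inv hh, inv_mul, mul_one']
  rw [← hL.mul_assoc hcR hh hf, e, hL.mul_assoc hh hnP hf]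

theorem inv (hr : hL.Rel P f g) (hf : 𝓛.Arrow Δ P f Q) :
    hL.Rel Q (𝓛.inv f) (𝓛.inv g) := by
  have hg := hr.arrow hf
  have h1 := (hr.mul_left hf.inv).mul_right (hf.inv.comp hL hf) hg.inv
  rw [inv_mul, one_mul', hL.mul_inv_cancel_right hf.inv hg] at h1
  exact h1.symm

/-- Congruence restricts to smaller objects, since `Θ` reverses inclusions of objects. -/
theorem restrict (hp : p.Prime) (hΔ : hL.IsObjectiveAlmostCharP) (hr : hL.Rel P f g)
    (hR : R ∈ Δ) (hRP : R ⊆ P) : hL.Rel R f g := by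
  obtain ⟨Q, hQ, n, hn, rfl⟩ := hr
  exact ⟨_, hL.arrow_restrict hQ hR hRP, n, hL.theta_antitone hp hΔ hR hQ.src hRP hn, rfl⟩

/-- One step of `Rel.extend`. For `a ∈ A`, the conjugates `a^f` and `a^g` are congruent modulo
`Θ(P^f)` and lie in `S`, so they agree; thus the element of `Θ(P)` relating `f` and `g`
centralizes `A`. -/
theorem extend_of_subset_normalizer (hp : p.Prime) (hΔ : hL.IsObjectiveAlmostCharP)
    (hr : hL.Rel P f g) {A : Set L} (hA : A ∈ Δ) (hPA : P ⊆ A) (hAf : A ⊆ 𝓛.sf S f)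
    (hAg : A ⊆ 𝓛.sf S g) (hAP : A ⊆ 𝓛.normalizer P) : hL.Rel A f g := by
  have hg := hr
  obtain ⟨Q, hQ, n, hn, rfl⟩ := hr
  have hP := hQ.src
  have hnP := hL.arrow_theta hP hn
  have key : ∀ a ∈ A, 𝓛.conj a n = a := by
    intro a ha
    have haP := (arrow_self_iff hP).2 (hAP ha)
    have hnQ := hL.conj_mem_theta hQ hn
    have h1 := hL.conj_conj haP hnP hnP hQ hQ
    have h2 : 𝓛.conj (𝓛.conj a f) (𝓛.conj n f) = 𝓛.conj (𝓛.conj a n) f := by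
      rw [h1, hL.conj_conj haP hQ hQ (hL.arrow_theta hQ.tgt hnQ) (hL.arrow_theta hQ.tgt hnQ),
        hL.mul_conj hnP hQ hQ]
    have h3 : 𝓛.conj (𝓛.conj a f) (𝓛.conj n f) = 𝓛.conj a f := by
      refine hL.conj_eq_of_mem_theta hQ.tgt hnQ ?_ (hAf ha).2.2 ?_
      · exact (arrow_self_iff hQ.tgt).1 (hL.arrow_conj haP hQ hQ)
      · rw [h2, h1]
        exact (hAg ha).2.2
    have han := hL.arrow_conj haP hnP hnP
    have h4 := congrArg (fun t => 𝓛.conj t (𝓛.inv f)) (h2.symm.trans h3)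
    rwa [(𝓛.inv_conj (hL.mem_conjDom han hQ hQ)).2, (𝓛.inv_conj (hAf ha).2.1).2] at h4
  have hnA : n ∈ 𝓛.normalizer A := hL.mem_normalizer_of_conj_mem fun a ha => by
    have haP := (arrow_self_iff hP).2 (hAP ha)
    exact ⟨hL.mem_conjDom haP hnP hnP, (key a ha).symm ▸ ha⟩
  refine ⟨_, hL.arrow_of_subset_sf hA hAf, n, ?_, rfl⟩
  rw [hL.theta_eq hp hΔ hP hA hPA]
  exact ⟨hn, hnA⟩

/-- Congruent elements remain congruent over the largest object on which both are defined. -/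
theorem extend (hp : p.Prime) (hΔ : hL.IsObjectiveAlmostCharP) (hr : hL.Rel P f g) :
    hL.Rel (𝓛.sf S f ∩ 𝓛.sf S g) f g := by
  have hQ := hL.inter_mem hr.src (hL.sf_mem f) (hL.isSubgroup_of_mem (hL.sf_mem g))
    hr.subset_left hr.subset_right
  refine hL.climb hp hQ (motive := fun X => hL.Rel X f g → hL.Rel _ f g) id ?_ P hr.src
    (Set.subset_inter hr.subset_left hr.subset_right) hr
  intro X hX hXQ ih hr
  refine ih (hr.extend_of_subset_normalizer hp hΔ (hL.inter_normalizer_mem hX hQ hXQ.1)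
    (Set.subset_inter hXQ.1 (hL.subset_normalizer hX)) ?_ ?_ Set.inter_subset_right)
  · exact Set.inter_subset_left.trans Set.inter_subset_left
  · exact Set.inter_subset_left.trans Set.inter_subset_right

end Rel

/-- An element `x ∈ Θ(P)` is congruent to `1` over `P`, so by `Rel.extend` it is over `S_x`. -/
theorem mem_theta_of_subset_sf (hL : 𝓛.IsLocality p Δ S) (hp : p.Prime)
    (hΔ : hL.IsObjectiveAlmostCharP) {x : L} (hx : x ∈ hL.Theta) {Q : Set L} (hQ : Q ∈ Δ)
    (hQx : Q ⊆ 𝓛.sf S x) : x ∈ hL.theta Q := by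
  obtain ⟨P, hP, hxP⟩ := hL.mem_Theta_iff.1 hx
  have hr : hL.Rel P 𝓛.one x := ⟨P, Arrow.one hP, x, hxP, (𝓛.mul_one' x).symm⟩
  have h1 : 𝓛.sf S 𝓛.one = S := hL.sf_eq_of_mem hL.isSubgroup.one_mem
  obtain ⟨_, -, n, hn, hxn⟩ := (hr.extend hp hΔ).restrict hp hΔ hQ
    (Set.subset_inter (h1.symm ▸ hL.subset_S hQ) hQx)
  rwa [hxn, mul_one']

theorem theta_eq_Theta_inter (hL : 𝓛.IsLocality p Δ S) (hp : p.Prime)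
    (hΔ : hL.IsObjectiveAlmostCharP) {P : Set L} (hP : P ∈ Δ) :
    hL.theta P = hL.Theta ∩ 𝓛.normalizer P :=
  Set.Subset.antisymm
    (Set.subset_inter (hL.theta_subset_Theta P) (hL.theta_subset_normalizer P))
    fun _ hx => hL.mem_theta_of_subset_sf hp hΔ hx.1 hP
      (hL.subset_sf ((arrow_self_iff hP).2 hx.2))

theorem Theta_inter_S (hL : 𝓛.IsLocality p Δ S) : hL.Theta ∩ S = {𝓛.one} := by
  ext x
  constructor
  · rintro ⟨hx, hxS⟩
    obtain ⟨P, -, hxP⟩ := hL.mem_Theta_iff.1 hx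
    exact hL.eq_one_of_mem_theta_of_mem_S hxP hxS
  · rintro rfl
    exact ⟨hL.theta_subset_Theta S (hL.theta_isSubgroup hL.S_mem).one_mem, hL.isSubgroup.one_mem⟩

/-- An arrow given by an element of `Θ` starts and ends at the same object. -/
theorem arrow_Theta_eq (hL : 𝓛.IsLocality p Δ S) (hp : p.Prime)
    (hΔ : hL.IsObjectiveAlmostCharP) {P Q : Set L} {n : L} (hn : n ∈ hL.Theta)
    (h : 𝓛.Arrow Δ P n Q) : n ∈ hL.theta P ∧ Q = P := by
  have hnP := hL.mem_theta_of_subset_sf hp hΔ hn h.src (hL.subset_sf h)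
  exact ⟨hnP, h.unique (hL.arrow_theta h.src hnP)⟩

theorem isPartialNormal_Theta (hL : 𝓛.IsLocality p Δ S) (hp : p.Prime)
    (hΔ : hL.IsObjectiveAlmostCharP) : 𝓛.IsPartialNormal hL.Theta := by
  refine ⟨⟨?_, ?_⟩, ?_⟩
  · intro x hx
    obtain ⟨P, hP, hxP⟩ := hL.mem_Theta_iff.1 hx
    exact hL.theta_subset_Theta P ((hL.theta_isSubgroup hP).inv_mem hxP)
  · intro w hw hwT
    obtain ⟨P, Q, hc⟩ := hL.mem_D_iff_chain.1 hw
    refine hL.theta_subset_Theta P ?_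
    have hP := hc.src
    have hwP : ∀ f ∈ w, f ∈ hL.theta P := by
      clear hw
      induction w with
      | nil => simp
      | cons f w ih =>
        obtain ⟨R, hR, hc⟩ := hc
        obtain ⟨hf, rfl⟩ := hL.arrow_Theta_eq hp hΔ (hwT f List.mem_cons_self) hR
        intro g hg
        rcases List.mem_cons.1 hg with rfl | hg
        · exact hf
        · exact ih (fun g hg => hwT g (List.mem_cons_of_mem _ hg)) hc g hg
    exact (hL.theta_isSubgroup hP).1.2 w hw hwP
  · intro f n hn hnf
    obtain ⟨R0, R4, R1, h1, R2, h2, R3, h3, -⟩ := hL.mem_D_iff_chain.1 hnf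
    obtain ⟨hnP, rfl⟩ := hL.arrow_Theta_eq hp hΔ hn h2
    exact hL.theta_subset_Theta R3 (hL.conj_mem_theta h3 hnP)

/-! ### Elements with maximal domain -/

/-- Congruent elements `f` and `g` are both congruent, over their whole domains `S_f` and `S_g`,
to a common element. If the object `P` over which they are congruent is smaller than `S_f` and
`S_g`, Sylow's theorem in `N_L(P)` provides `k ∈ Θ(P)` such that `kf` conjugates both `N_{S_f}(P)`
and `N_{S_g}(P)` into `S`. -/
theorem exists_rel_sf (hL : 𝓛.IsLocality p Δ S) (hp : p.Prime)
    (hΔ : hL.IsObjectiveAlmostCharP) {P : Set L} {f g : L} (hr : hL.Rel P f g) :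
    ∃ h, hL.Rel (𝓛.sf S f) f h ∧ hL.Rel (𝓛.sf S g) g h := by
  have := hL.finite
  induction P using WellFoundedGT.induction generalizing f g with
  | ind P ih =>
    have hrf := Rel.of_arrow (hL := hL) (hL.arrow_of_subset_sf (hL.sf_mem f) subset_rfl)
    have hrg := Rel.of_arrow (hL := hL) (hL.arrow_of_subset_sf (hL.sf_mem g) subset_rfl)
    rcases hr.subset_left.eq_or_ssubset with heq | hPf
    · exact ⟨g, heq ▸ hr, hrg⟩
    rcases hr.subset_right.eq_or_ssubset with heq | hPg
    · exact ⟨f, hrf, heq ▸ hr.symm⟩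
    have hP := hr.src
    have hA := hL.ssubset_inter_normalizer hp hP (hL.sf_mem f) hPf
    have hB := hL.ssubset_inter_normalizer hp hP (hL.sf_mem g) hPg
    have hAm := hL.inter_normalizer_mem hP (hL.sf_mem f) hPf.1
    have hBm := hL.inter_normalizer_mem hP (hL.sf_mem g) hPg.1
    -- It suffices to extend the domain of `f` over both normalizers.
    obtain ⟨h, hrh, hAh, hBh⟩ : ∃ h, hL.Rel P f h ∧ 𝓛.sf S f ∩ 𝓛.normalizer P ⊆ 𝓛.sf S h ∧
        𝓛.sf S g ∩ 𝓛.normalizer P ⊆ 𝓛.sf S h := by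
      obtain ⟨Q, hQ, n, hn, rfl⟩ := hr
      have hG := hL.isSubgroup_normalizer hP
      let N := hL.NormalizerGroup hP
      let R0 : Subgroup N := hL.isSubgroup.restrict hG
      let e := hL.conjEquiv hP hQ.tgt hQ
      -- The elements of `N_L(P)` that `f` conjugates into `S`.
      let R : Subgroup N := (hL.isSubgroup.restrict (hL.isSubgroup_normalizer hQ.tgt)).comap
        e.toMonoidHom
      have hR0 : IsPGroup p R0 := hL.isPGroup_restrict_S hG
      have hR : IsPGroup p R :=
        (hL.isPGroup_restrict_S _).comap_of_injective e.toMonoidHom e.injective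
      obtain ⟨k, hk, hkR⟩ := exists_conj_mem_of_le_sup (G := N) hp (K := OpPrime p N) (T := R)
        (A := R0 ⊓ (OpPrime p N ⊔ R)) (OpPrime.card_coprime p N) hR (hR0.to_le inf_le_left)
        inf_le_right
      have hkP : k.val ∈ hL.theta P := (hL.mem_theta hP).2 hk
      have hkA := hL.arrow_theta hP hkP
      -- `h = k f` conjugates into `S` every `a ∈ N_S(P)` that lies in `R` modulo `Θ(P)`.
      have key : ∀ (a : L) (haN : a ∈ 𝓛.normalizer P), a ∈ S →
          hG.mk a haN ∈ OpPrime p N ⊔ R → a ∈ 𝓛.sf S (𝓛.mul k.val f) := by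
        intro a haN haS hle
        have haP := (arrow_self_iff hP).2 haN
        have h1 := hkR (hG.mk a haN) ⟨haS, hle⟩
        refine ⟨haS, hL.mem_conjDom haP (hkA.comp hL hQ) (hkA.comp hL hQ), ?_⟩
        rw [← hL.conj_conj haP hkA hkA hQ hQ]
        have h2 : 𝓛.conj (k⁻¹ * hG.mk a haN * k).val f ∈ S := h1
        rwa [IsSubgroup.Elems.val_conj] at h2
      refine ⟨𝓛.mul k.val f, ⟨Q, hQ, k.val, hkP, rfl⟩, ?_, ?_⟩
      · intro a ha
        exact key a ha.2 ha.1.1 (le_sup_right (a := OpPrime p N) (show _ ∈ R from ha.1.2.2))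
      · intro b hb
        have hbP := (arrow_self_iff hP).2 hb.2
        have hnP := hL.arrow_theta hP hn
        refine key b hb.2 hb.1.1 ?_
        obtain ⟨_, y, hy, rfl⟩ := hn
        -- Here `g = n f`, so `b^n ∈ R` and `b` is congruent to `b^n` modulo `Θ(P)`.
        have h1 : y⁻¹ * hG.mk b hb.2 * y ∈ R := by
          change 𝓛.conj (y⁻¹ * hG.mk b hb.2 * y).val f ∈ S
          rw [IsSubgroup.Elems.val_conj]
          change 𝓛.conj (𝓛.conj b y.val) f ∈ S
          rw [hL.conj_conj hbP hnP hnP hQ hQ]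
          exact hb.1.2.2
        have h2 := (OpPrime p N ⊔ R).mul_mem ((OpPrime p N ⊔ R).mul_mem
          (le_sup_left (b := R) hy) (le_sup_right (a := OpPrime p N) h1))
          (le_sup_left (b := R) ((OpPrime p N).inv_mem hy))
        simpa [_root_.mul_assoc] using h2
    have hrA := hrh.extend_of_subset_normalizer hp hΔ hAm hA.1 Set.inter_subset_left hAh
      Set.inter_subset_right
    have hrB := (hr.symm.trans hrh).extend_of_subset_normalizer hp hΔ hBm hB.1
      Set.inter_subset_left hBh Set.inter_subset_right
    -- Two applications of induction: to `f` and `h`, and then to `g` and the element obtained.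
    obtain ⟨h1, hf1, hh1⟩ := ih _ hA hrA
    obtain ⟨h2, hg2, h12⟩ := ih _ hB (hrB.trans (hh1.restrict hp hΔ hBm hBh))
    exact ⟨h2, hf1.trans (h12.restrict hp hΔ (hL.sf_mem f) hf1.subset_right), hg2⟩

/-- `m` cannot be replaced by an element of `Θ(S_m) m` with larger domain. -/
def IsMax (hL : 𝓛.IsLocality p Δ S) (m : L) : Prop :=
  ∀ g, hL.Rel (𝓛.sf S m) m g → 𝓛.sf S g ⊆ 𝓛.sf S m

theorem rel_refl (hL : 𝓛.IsLocality p Δ S) {P : Set L} (hP : P ∈ Δ) {f : L}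
    (h : P ⊆ 𝓛.sf S f) : hL.Rel P f f :=
  Rel.of_arrow (hL.arrow_of_subset_sf hP h)

theorem exists_isMax (hL : 𝓛.IsLocality p Δ S) (hp : p.Prime)
    (hΔ : hL.IsObjectiveAlmostCharP) (f : L) : ∃ m, hL.IsMax m ∧ hL.Rel (𝓛.sf S f) f m := by
  have := hL.finite
  induction h : 𝓛.sf S f using WellFoundedGT.induction generalizing f with
  | ind X ih =>
    subst h
    by_cases hf : hL.IsMax f
    · exact ⟨f, hf, hL.rel_refl (hL.sf_mem f) subset_rfl⟩
    · simp only [IsMax, not_forall] at hf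
      obtain ⟨g, hr, hg⟩ := hf
      obtain ⟨m, hm, hgm⟩ := ih _ ⟨hr.subset_right, hg⟩ g rfl
      exact ⟨m, hm, hr.trans (hgm.restrict hp hΔ (hL.sf_mem f) hr.subset_right)⟩

/-- An element congruent over some object to `m` with maximal domain is congruent to `m` over its
whole domain. -/
theorem IsMax.rel_sf {hL : 𝓛.IsLocality p Δ S} {m g : L} (hm : hL.IsMax m) (hp : p.Prime)
    (hΔ : hL.IsObjectiveAlmostCharP) {P : Set L} (hr : hL.Rel P m g) :
    hL.Rel (𝓛.sf S g) g m := by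
  obtain ⟨h, h1, h2⟩ := hL.exists_rel_sf hp hΔ hr
  exact h2.trans (h1.symm.restrict hp hΔ (hL.sf_mem g) (h2.subset_right.trans (hm h h1)))

theorem isMax_of_mem (hL : 𝓛.IsLocality p Δ S) {x : L} (hx : x ∈ S) : hL.IsMax x := by
  intro g _
  rw [hL.sf_eq_of_mem hx]
  exact sf_subset g

theorem sf_inv (hL : 𝓛.IsLocality p Δ S) (f : L) :
    𝓛.sf S (𝓛.inv f) = 𝓛.conjSet (𝓛.sf S f) f := by
  have h1 := hL.arrow_of_subset_sf (hL.sf_mem f) subset_rfl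
  refine Set.Subset.antisymm ?_ (hL.subset_sf h1.inv)
  intro y hy
  have h := 𝓛.inv_conj hy.2.1
  rw [𝓛.inv_inv] at h
  refine ⟨𝓛.conj y (𝓛.inv f), ⟨hy.2.2, h.1, ?_⟩, h.2⟩
  rw [h.2]
  exact hy.1

theorem IsMax.inv {hL : 𝓛.IsLocality p Δ S} {m : L} (hm : hL.IsMax m) :
    hL.IsMax (𝓛.inv m) := by
  intro g hr
  have h1 := hL.arrow_of_subset_sf (hL.sf_mem m) subset_rfl
  rw [hL.sf_inv] at hr ⊢
  have h2 := hr.inv h1.inv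
  rw [𝓛.inv_inv] at h2
  have h3 := hm _ h2
  have h4 := hL.arrow_of_subset_sf (hL.sf_mem g) subset_rfl
  rw [hL.sf_inv] at h3
  have h5 := hr.arrow h1.inv
  intro y hy
  have h7 := (𝓛.inv_conj (h4.sub hy)).2
  rw [← h7, ← h5.inv.eq]
  exact ⟨_, h3 ⟨y, hy, rfl⟩, rfl⟩

end IsLocality

end PartialGroup

/-! ### The quotient partial group -/

namespace PartialGroup

section Image

variable {L : Type u} (𝓛 : PartialGroup L) {X : Type v}

/-- The partial group structure on the image `X` of `ρ : L → X`, for a map `ρ` with section `σ`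
whose fibres are compatible with products and inverses; its domain is the image of `𝓛.D`. -/
def image (ρ : L → X) (σ : X → L) (hσ : ∀ c, ρ (σ c) = c)
    (hprod : ∀ w ∈ 𝓛.D, ρ (𝓛.prod ((w.map ρ).map σ)) = ρ (𝓛.prod w))
    (hinv : ∀ f, ρ (𝓛.inv (σ (ρ f))) = ρ (𝓛.inv f)) : PartialGroup X where
  D := List.map ρ '' 𝓛.D
  prod c := ρ (𝓛.prod (c.map σ))
  inv c := ρ (𝓛.inv (σ c))
  inv_inv c := by rw [hinv, 𝓛.inv_inv, hσ]
  single_mem c := ⟨[σ c], 𝓛.single_mem _, by simp [hσ]⟩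
  mem_of_append a b := by
    rintro ⟨w, hw, h⟩
    obtain ⟨a, b, rfl, rfl, rfl⟩ := List.map_eq_append_iff.1 h
    have := 𝓛.mem_of_append a b hw
    exact ⟨⟨a, this.1, rfl⟩, ⟨b, this.2, rfl⟩⟩
  prod_single c := by simp [𝓛.prod_single, hσ]
  collapse_mem a b c := by
    rintro ⟨w, hw, h⟩
    obtain ⟨ab, c, rfl, hab, rfl⟩ := List.map_eq_append_iff.1 h
    obtain ⟨a, b, rfl, rfl, rfl⟩ := List.map_eq_append_iff.1 hab
    have hb := (𝓛.mem_of_append _ _ (𝓛.mem_of_append _ _ hw).1).2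
    exact ⟨_, 𝓛.collapse_mem a b c hw, by rw [hprod b hb]; simp⟩
  prod_collapse a b c := by
    rintro ⟨w, hw, h⟩
    obtain ⟨ab, c, rfl, hab, rfl⟩ := List.map_eq_append_iff.1 h
    obtain ⟨a, b, rfl, rfl, rfl⟩ := List.map_eq_append_iff.1 hab
    have hb := (𝓛.mem_of_append _ _ (𝓛.mem_of_append _ _ hw).1).2
    have h1 := hprod _ hw
    have h2 := hprod _ (𝓛.collapse_mem a b c hw)
    rw [hprod b hb]
    simp only [List.map_append, List.map_cons, List.map_nil] at h1 h2 ⊢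
    rw [h1, h2, 𝓛.prod_collapse a b c hw]
  inv_append_mem v := by
    rintro ⟨w, hw, rfl⟩
    refine ⟨_, 𝓛.inv_append_mem w hw, ?_⟩
    simp [hinv, Function.comp_def]
  prod_inv_append v := by
    rintro ⟨w, hw, rfl⟩
    have h := hprod _ (𝓛.inv_append_mem w hw)
    rw [𝓛.prod_inv_append w hw] at h
    rw [List.map_nil, ← h]
    simp [hinv, Function.comp_def]

end Image

/-- A projection of partial groups: `ρ` respects products and inverses, and the domain of the
target is the image of the domain of the source. -/
structure IsProjection {L : Type u} {X : Type v} (𝓛 : PartialGroup L) (𝓠 : PartialGroup X)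
    (ρ : L → X) : Prop where
  dom : 𝓠.D = List.map ρ '' 𝓛.D
  prod_map : ∀ w ∈ 𝓛.D, 𝓠.prod (w.map ρ) = ρ (𝓛.prod w)
  inv_map : ∀ f, 𝓠.inv (ρ f) = ρ (𝓛.inv f)

namespace IsProjection

variable {L : Type u} {X : Type v} {𝓛 : PartialGroup L} {𝓠 : PartialGroup X} {ρ : L → X}

theorem map_mem (h : 𝓛.IsProjection 𝓠 ρ) {w : List L} (hw : w ∈ 𝓛.D) : w.map ρ ∈ 𝓠.D :=
  h.dom ▸ ⟨w, hw, rfl⟩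

theorem one_map (h : 𝓛.IsProjection 𝓠 ρ) : ρ 𝓛.one = 𝓠.one := (h.prod_map [] 𝓛.nil_mem).symm

theorem mem_conjDom (h : 𝓛.IsProjection 𝓠 ρ) {x f : L} (hx : x ∈ 𝓛.conjDom f) :
    ρ x ∈ 𝓠.conjDom (ρ f) := by
  have := h.map_mem hx
  simpa [conjDom, h.inv_map] using this

theorem conj_map (h : 𝓛.IsProjection 𝓠 ρ) {x f : L} (hx : x ∈ 𝓛.conjDom f) :
    𝓠.conj (ρ x) (ρ f) = ρ (𝓛.conj x f) := by
  have := h.prod_map _ hx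
  simpa [conj, h.inv_map] using this

theorem conjSet_map (h : 𝓛.IsProjection 𝓠 ρ) {P : Set L} {f : L} (hP : P ⊆ 𝓛.conjDom f) :
    ρ '' P ⊆ 𝓠.conjDom (ρ f) ∧ 𝓠.conjSet (ρ '' P) (ρ f) = ρ '' 𝓛.conjSet P f := by
  constructor
  · rintro _ ⟨x, hx, rfl⟩
    exact h.mem_conjDom (hP hx)
  · rw [conjSet, conjSet, Set.image_image, Set.image_image]
    exact Set.image_congr fun x hx => h.conj_map (hP hx)

theorem image_normalizer_subset (h : 𝓛.IsProjection 𝓠 ρ) (P : Set L) :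
    ρ '' 𝓛.normalizer P ⊆ 𝓠.normalizer (ρ '' P) := by
  rintro _ ⟨f, hf, rfl⟩
  have := h.conjSet_map hf.1
  rw [hf.2] at this
  exact this

theorem isSubgroup_image (h : 𝓛.IsProjection 𝓠 ρ) {H : Set L} (hH : 𝓛.IsSubgroup H) :
    𝓠.IsSubgroup (ρ '' H) := by
  have lift : ∀ v : List X, (∀ c ∈ v, c ∈ ρ '' H) → ∃ w : List L, (∀ f ∈ w, f ∈ H) ∧
      w.map ρ = v := by
    intro v hv
    induction v with
    | nil => exact ⟨[], by simp, rfl⟩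
    | cons c v ih =>
      obtain ⟨f, hf, rfl⟩ := hv c List.mem_cons_self
      obtain ⟨w, hw, rfl⟩ := ih fun d hd => hv d (List.mem_cons_of_mem _ hd)
      exact ⟨f :: w, by simpa [hf] using hw, rfl⟩
  refine ⟨⟨?_, ?_⟩, ?_⟩
  · rintro _ ⟨f, hf, rfl⟩
    exact ⟨_, hH.inv_mem hf, (h.inv_map f).symm⟩
  · intro v _ hv
    obtain ⟨w, hw, rfl⟩ := lift v hv
    exact ⟨_, hH.1.2 w (hH.2 w hw) hw, (h.prod_map w (hH.2 w hw)).symm⟩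
  · intro v hv
    obtain ⟨w, hw, rfl⟩ := lift v hv
    exact h.map_mem (hH.2 w hw)

/-- The group homomorphism induced by a projection on a subgroup. -/
def hom (h : 𝓛.IsProjection 𝓠 ρ) {H : Set L} {K : Set X} (hH : 𝓛.IsSubgroup H)
    (hK : 𝓠.IsSubgroup K) (hHK : ρ '' H ⊆ K) : hH.Elems →* hK.Elems where
  toFun x := hK.mk (ρ x.val) (hHK ⟨_, x.mem, rfl⟩)
  map_one' := IsSubgroup.Elems.ext h.one_map
  map_mul' x y := IsSubgroup.Elems.ext
    (h.prod_map [x.val, y.val] (hH.2 _ (by simp [x.mem, y.mem]))).symm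

end IsProjection

variable {L : Type u} {𝓛 : PartialGroup L} {Δ : Set (Set L)} {S : Set L} {p : ℕ}

namespace IsLocality

/-- The right coset `Θ f` consists of the elements congruent to `f` over some object. -/
theorem mem_rightCoset_iff (hL : 𝓛.IsLocality p Δ S) (hp : p.Prime)
    (hΔ : hL.IsObjectiveAlmostCharP) {f g : L} :
    g ∈ 𝓛.rightCoset hL.Theta f ↔ ∃ P, hL.Rel P f g := by
  constructor
  · rintro ⟨n, hn, hD, rfl⟩
    obtain ⟨P, Q, R, hnP, Q, hf, -⟩ := hL.mem_D_iff_chain.1 hD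
    obtain ⟨hnP, rfl⟩ := hL.arrow_Theta_eq hp hΔ hn hnP
    exact ⟨_, Q, hf, n, hnP, rfl⟩
  · rintro ⟨P, Q, hf, n, hn, rfl⟩
    exact ⟨n, hL.theta_subset_Theta P hn, hL.mem_D_pair (hL.arrow_theta hf.src hn) hf, rfl⟩

theorem IsMax.rightCoset_subset {hL : 𝓛.IsLocality p Δ S} {m f : L} (hm : hL.IsMax m)
    (hp : p.Prime) (hΔ : hL.IsObjectiveAlmostCharP) {P : Set L} (hr : hL.Rel P f m) :
    𝓛.rightCoset hL.Theta f ⊆ 𝓛.rightCoset hL.Theta m := by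
  intro g hg
  rw [hL.mem_rightCoset_iff hp hΔ] at hg ⊢
  obtain ⟨Q, hQ⟩ := hg
  exact ⟨Q, ((hm.rel_sf hp hΔ hr.symm).restrict hp hΔ hQ.src hQ.subset_left).symm.trans hQ⟩

theorem mem_rightCoset_self (hL : 𝓛.IsLocality p Δ S) (hp : p.Prime)
    (hΔ : hL.IsObjectiveAlmostCharP) (f : L) : f ∈ 𝓛.rightCoset hL.Theta f :=
  (hL.mem_rightCoset_iff hp hΔ).2 ⟨_, hL.rel_refl (hL.sf_mem f) subset_rfl⟩

theorem IsMax.maximal_rightCoset {hL : 𝓛.IsLocality p Δ S} {m : L} (hm : hL.IsMax m)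
    (hp : p.Prime) (hΔ : hL.IsObjectiveAlmostCharP) :
    Maximal (fun X => ∃ f, X = 𝓛.rightCoset hL.Theta f) (𝓛.rightCoset hL.Theta m) := by
  refine ⟨⟨m, rfl⟩, ?_⟩
  rintro _ ⟨g, rfl⟩ hle
  obtain ⟨P, hP⟩ := (hL.mem_rightCoset_iff hp hΔ).1 (hle (hL.mem_rightCoset_self hp hΔ m))
  exact hm.rightCoset_subset hp hΔ hP

/-- Every maximal right coset is the right coset of an element with maximal domain. -/
theorem exists_isMax_rightCoset_eq (hL : 𝓛.IsLocality p Δ S) (hp : p.Prime)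
    (hΔ : hL.IsObjectiveAlmostCharP) (C : 𝓛.MaxRightCoset hL.Theta) :
    ∃ m, hL.IsMax m ∧ C.1 = 𝓛.rightCoset hL.Theta m := by
  obtain ⟨f, hf⟩ := C.2.1
  obtain ⟨m, hm, hr⟩ := hL.exists_isMax hp hΔ f
  have hle : C.1 ⊆ 𝓛.rightCoset hL.Theta m := hf ▸ hm.rightCoset_subset hp hΔ hr
  exact ⟨m, hm, hle.antisymm (C.2.2 ⟨m, rfl⟩ hle)⟩

/-- The maximal right coset containing `f`. -/
def rho (hL : 𝓛.IsLocality p Δ S) (hp : p.Prime) (hΔ : hL.IsObjectiveAlmostCharP) (f : L) :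
    𝓛.MaxRightCoset hL.Theta :=
  ⟨_, (hL.exists_isMax hp hΔ f).choose_spec.1.maximal_rightCoset hp hΔ⟩

theorem mem_iff_eq_rho (hL : 𝓛.IsLocality p Δ S) (hp : p.Prime)
    (hΔ : hL.IsObjectiveAlmostCharP) (g : L) (C : 𝓛.MaxRightCoset hL.Theta) :
    g ∈ C.1 ↔ C = hL.rho hp hΔ g := by
  obtain ⟨hm', hr'⟩ := (hL.exists_isMax hp hΔ g).choose_spec
  constructor
  · intro hg
    obtain ⟨m, hm, hC⟩ := hL.exists_isMax_rightCoset_eq hp hΔ C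
    rw [hC, hL.mem_rightCoset_iff hp hΔ] at hg
    obtain ⟨P, hP⟩ := hg
    have h := (hm.rel_sf hp hΔ hP).symm.trans hr'
    refine Subtype.ext (hC.trans ?_)
    exact (hm'.rightCoset_subset hp hΔ h).antisymm (hm.rightCoset_subset hp hΔ h.symm)
  · rintro rfl
    exact (hL.mem_rightCoset_iff hp hΔ).2 ⟨_, hr'.symm⟩

theorem IsMax.rho_val {hL : 𝓛.IsLocality p Δ S} {m : L} (hm : hL.IsMax m) (hp : p.Prime)
    (hΔ : hL.IsObjectiveAlmostCharP) :
    (hL.rho hp hΔ m).1 = 𝓛.rightCoset hL.Theta m :=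
  (congrArg Subtype.val ((hL.mem_iff_eq_rho hp hΔ m ⟨_, hm.maximal_rightCoset hp hΔ⟩).1
    (hL.mem_rightCoset_self hp hΔ m))).symm

theorem rho_eq_of_rel (hL : 𝓛.IsLocality p Δ S) (hp : p.Prime)
    (hΔ : hL.IsObjectiveAlmostCharP) {P : Set L} {f g : L} (hr : hL.Rel P f g) :
    hL.rho hp hΔ f = hL.rho hp hΔ g := by
  obtain ⟨m, hm, hC⟩ := hL.exists_isMax_rightCoset_eq hp hΔ (hL.rho hp hΔ f)
  have hf := (hL.mem_iff_eq_rho hp hΔ f _).2 rfl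
  rw [hC, hL.mem_rightCoset_iff hp hΔ] at hf
  obtain ⟨Q, hQ⟩ := hf
  rw [← hL.mem_iff_eq_rho hp hΔ, hC, hL.mem_rightCoset_iff hp hΔ]
  exact ⟨P, ((hm.rel_sf hp hΔ hQ).restrict hp hΔ hr.src hr.subset_left).symm.trans hr⟩

theorem IsMax.rel_of_rho_eq {hL : 𝓛.IsLocality p Δ S} {m : L} (hm : hL.IsMax m)
    {hp : p.Prime} {hΔ : hL.IsObjectiveAlmostCharP} {f : L}
    (h : hL.rho hp hΔ f = hL.rho hp hΔ m) : hL.Rel (𝓛.sf S f) f m := by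
  have hf := (hL.mem_iff_eq_rho hp hΔ f _).2 rfl
  rw [h, hm.rho_val, hL.mem_rightCoset_iff hp hΔ] at hf
  obtain ⟨P, hP⟩ := hf
  exact hm.rel_sf hp hΔ hP

theorem exists_isMax_rho_eq (hL : 𝓛.IsLocality p Δ S) (hp : p.Prime)
    (hΔ : hL.IsObjectiveAlmostCharP) (C : 𝓛.MaxRightCoset hL.Theta) :
    ∃ m, hL.IsMax m ∧ hL.rho hp hΔ m = C := by
  obtain ⟨m, hm, hC⟩ := hL.exists_isMax_rightCoset_eq hp hΔ C
  exact ⟨m, hm, Subtype.ext ((hm.rho_val hp hΔ).trans hC.symm)⟩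

/-- A representative of a maximal right coset with maximal domain. -/
noncomputable def sigma (hL : 𝓛.IsLocality p Δ S) (hp : p.Prime) (hΔ : hL.IsObjectiveAlmostCharP)
    (C : 𝓛.MaxRightCoset hL.Theta) : L := (hL.exists_isMax_rho_eq hp hΔ C).choose

theorem isMax_sigma (hL : 𝓛.IsLocality p Δ S) (hp : p.Prime) (hΔ : hL.IsObjectiveAlmostCharP)
    (C : 𝓛.MaxRightCoset hL.Theta) : hL.IsMax (hL.sigma hp hΔ C) :=
  (hL.exists_isMax_rho_eq hp hΔ C).choose_spec.1

theorem rho_sigma (hL : 𝓛.IsLocality p Δ S) (hp : p.Prime) (hΔ : hL.IsObjectiveAlmostCharP)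
    (C : 𝓛.MaxRightCoset hL.Theta) : hL.rho hp hΔ (hL.sigma hp hΔ C) = C :=
  (hL.exists_isMax_rho_eq hp hΔ C).choose_spec.2

theorem rel_sigma_rho (hL : 𝓛.IsLocality p Δ S) (hp : p.Prime)
    (hΔ : hL.IsObjectiveAlmostCharP) (f : L) :
    hL.Rel (𝓛.sf S f) f (hL.sigma hp hΔ (hL.rho hp hΔ f)) :=
  (hL.isMax_sigma hp hΔ _).rel_of_rho_eq (hL.rho_sigma hp hΔ _).symm

/-- Replacing the entries of a word of the domain by representatives with maximal domain changes
the product only within its maximal right coset. -/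
theorem rel_prod_map_sigma (hL : 𝓛.IsLocality p Δ S) (hp : p.Prime)
    (hΔ : hL.IsObjectiveAlmostCharP) {w : List L} {P Q : Set L} (h : 𝓛.Chain Δ w P Q) :
    𝓛.Chain Δ ((w.map (hL.rho hp hΔ)).map (hL.sigma hp hΔ)) P Q ∧
      hL.Rel P (𝓛.prod w) (𝓛.prod ((w.map (hL.rho hp hΔ)).map (hL.sigma hp hΔ))) := by
  induction w generalizing P with
  | nil => exact ⟨h, Rel.of_arrow (hL.arrow_prod h)⟩
  | cons f w ih =>
    have hD := hL.mem_D_iff_chain.2 ⟨P, Q, h⟩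
    obtain ⟨R, hf, hw⟩ := h
    obtain ⟨hw', hr⟩ := ih hw
    have hrf := (hL.rel_sigma_rho hp hΔ f).restrict hp hΔ hf.src (hL.subset_sf hf)
    have hc : 𝓛.Chain Δ (((f :: w).map (hL.rho hp hΔ)).map (hL.sigma hp hΔ)) P Q :=
      ⟨R, hrf.arrow hf, hw'⟩
    refine ⟨hc, ?_⟩
    have hD' := hL.mem_D_iff_chain.2 ⟨P, Q, hc⟩
    rw [𝓛.prod_cons hD]
    rw [List.map_cons, List.map_cons] at hD' ⊢
    rw [𝓛.prod_cons hD']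
    exact (hr.mul_left hf).trans (hrf.mul_right hf (hL.arrow_prod hw'))

/-- The quotient partial group `L / Θ`. -/
noncomputable def quotient (hL : 𝓛.IsLocality p Δ S) (hp : p.Prime) (hΔ : hL.IsObjectiveAlmostCharP) :
    PartialGroup (𝓛.MaxRightCoset hL.Theta) :=
  𝓛.image (hL.rho hp hΔ) (hL.sigma hp hΔ) (hL.rho_sigma hp hΔ)
    (fun w hw => by
      obtain ⟨P, Q, hc⟩ := hL.mem_D_iff_chain.1 hw
      exact (hL.rho_eq_of_rel hp hΔ (hL.rel_prod_map_sigma hp hΔ hc).2).symm)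
    (fun f => (hL.rho_eq_of_rel hp hΔ ((hL.rel_sigma_rho hp hΔ f).inv
      (hL.arrow_of_subset_sf (hL.sf_mem f) subset_rfl))).symm)

theorem isProjection_rho (hL : 𝓛.IsLocality p Δ S) (hp : p.Prime)
    (hΔ : hL.IsObjectiveAlmostCharP) :
    𝓛.IsProjection (hL.quotient hp hΔ) (hL.rho hp hΔ) where
  dom := rfl
  prod_map w hw := by
    obtain ⟨P, Q, hc⟩ := hL.mem_D_iff_chain.1 hw
    exact (hL.rho_eq_of_rel hp hΔ (hL.rel_prod_map_sigma hp hΔ hc).2).symm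
  inv_map f := (hL.rho_eq_of_rel hp hΔ ((hL.rel_sigma_rho hp hΔ f).inv
      (hL.arrow_of_subset_sf (hL.sf_mem f) subset_rfl))).symm

theorem isQuotient (hL : 𝓛.IsLocality p Δ S) (hp : p.Prime)
    (hΔ : hL.IsObjectiveAlmostCharP) :
    𝓛.IsQuotient hL.Theta (hL.quotient hp hΔ) (hL.rho hp hΔ) where
  mem_iff := hL.mem_iff_eq_rho hp hΔ
  dom := (hL.isProjection_rho hp hΔ).dom
  prod_map := (hL.isProjection_rho hp hΔ).prod_map

/-- `Θ` is the kernel of the projection. -/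
theorem rho_eq_one_iff (hL : 𝓛.IsLocality p Δ S) (hp : p.Prime)
    (hΔ : hL.IsObjectiveAlmostCharP) {x : L} :
    hL.rho hp hΔ x = (hL.quotient hp hΔ).one ↔ x ∈ hL.Theta := by
  rw [← (hL.isProjection_rho hp hΔ).one_map]
  constructor
  · intro h
    obtain ⟨Q, -, n, hn, hx⟩ := ((hL.isMax_of_mem hL.isSubgroup.one_mem).rel_of_rho_eq h).symm
    rw [hx, mul_one']
    exact hL.theta_subset_Theta _ hn
  · intro hx
    obtain ⟨P, hP, hxP⟩ := hL.mem_Theta_iff.1 hx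
    exact (hL.rho_eq_of_rel hp hΔ ⟨P, Arrow.one hP, x, hxP, (𝓛.mul_one' x).symm⟩).symm

/-- The projection is injective on `S`: elements of `S` have domain `S`, so if they lie in the same
maximal coset, they differ by an element of `Θ(S) ∩ S = 1`. -/
theorem rho_injOn (hL : 𝓛.IsLocality p Δ S) (hp : p.Prime) (hΔ : hL.IsObjectiveAlmostCharP) :
    Set.InjOn (hL.rho hp hΔ) S := by
  intro s hs t ht h
  have hr := (hL.isMax_of_mem ht).rel_of_rho_eq h
  rw [hL.sf_eq_of_mem hs] at hr
  obtain ⟨Q, -, n, hn, rfl⟩ := hr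
  have hnS : n ∈ S := by
    have := hL.isSubgroup.mul_mem ht (hL.isSubgroup.inv_mem hs)
    rwa [hL.mul_inv_cancel_right (hL.arrow_theta hL.S_mem hn) (hL.arrow_of_mem hL.S_mem hs)] at this
  rw [hL.eq_one_of_mem_theta_of_mem_S hn hnS, one_mul']

/-! ### Conjugation into `S` in the quotient -/

/-- An element of `N_S(S_m)` whose conjugate under `m` is congruent to an element of `S` modulo
`Θ(S_m^m)` lies in `S_m`, if `m` has maximal domain: otherwise Sylow's theorem in `N_L(S_m^m)`
gives `k ∈ Θ(S_m^m)` such that `mk` has larger domain than `m`. -/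
theorem IsMax.mem_sf_of_rel {hL : 𝓛.IsLocality p Δ S} {m : L} (hm : hL.IsMax m) (hp : p.Prime)
    {x s : L} (hxS : x ∈ S) (hs : s ∈ S)
    (hx : x ∈ 𝓛.normalizer (𝓛.sf S m))
    (hr : hL.Rel (𝓛.conjSet (𝓛.sf S m) m) (𝓛.conj x m) s) : x ∈ 𝓛.sf S m := by
  have := hL.finite
  have hT := hL.sf_mem m
  have hmT := hL.arrow_of_subset_sf hT subset_rfl
  have hT' := hmT.tgt
  have hxT := (arrow_self_iff hT).2 hx
  have hG := hL.isSubgroup_normalizer hT'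
  let N := hL.NormalizerGroup hT'
  let e := hL.conjEquiv hT hT' hmT
  let x' := (hL.isSubgroup_normalizer hT).mk x hx
  have hc : (e x').val = 𝓛.conj x m := rfl
  have hcT := hL.arrow_conj hxT hmT hmT
  have hsN := (arrow_self_iff hT').1 (hr.arrow hcT)
  let s' : N := hG.mk s hsN
  have hs' : s' ∈ hL.isSubgroup.restrict hG := hs
  have hxp : ∃ k, (e x') ^ p ^ k = 1 := by
    obtain ⟨k, hk⟩ := (hL.isPGroup_restrict_S (hL.isSubgroup_normalizer hT)) ⟨x', hxS⟩
    refine ⟨k, ?_⟩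
    rw [← map_pow, show x' ^ p ^ k = 1 from congrArg Subtype.val hk, map_one]
  obtain ⟨k, hk⟩ := hxp
  obtain ⟨_, -, n, hn, hsn⟩ := hr
  obtain ⟨_, n', hn', rfl⟩ := hn
  have hsn' : s' = n' * e x' := IsSubgroup.Elems.ext hsn
  have hmem : e x' ∈ OpPrime p N ⊔ hL.isSubgroup.restrict hG := by
    have h1 : e x' = n'⁻¹ * s' := by rw [hsn']; simp
    rw [h1]
    exact Subgroup.mul_mem_sup (Subgroup.inv_mem _ hn') hs'
  obtain ⟨l, hl, hlS⟩ := exists_conj_mem_of_le_sup hp (OpPrime.card_coprime p N)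
    (hL.isPGroup_restrict_S hG) (isPGroup_zpowers hk) (Subgroup.zpowers_le.2 hmem)
  have hlT := (hL.mem_theta hT').2 hl
  have hlA := hL.arrow_theta hT' hlT
  have hrel : hL.Rel (𝓛.sf S m) m (𝓛.mul m l.val) := by
    have : hL.Rel (𝓛.conjSet (𝓛.sf S m) m) 𝓛.one l.val :=
      ⟨_, Arrow.one hT', l.val, hlT, (𝓛.mul_one' _).symm⟩
    have := this.mul_left hmT
    rwa [mul_one'] at this
  refine hm _ hrel ⟨hxS, hL.mem_conjDom hxT (hmT.comp hL hlA) (hmT.comp hL hlA), ?_⟩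
  rw [← hL.conj_conj hxT hmT hmT hlA hlA]
  have h2 : (l⁻¹ * e x' * l).val ∈ S := hlS _ (Subgroup.mem_zpowers _)
  rwa [IsSubgroup.Elems.val_conj] at h2

/-- If `m` has maximal domain, then `x ∈ S` is conjugated into `S` by `m` as soon as this holds
in the quotient. Let `T = S_m`. The element `g = x⁻¹ m s` is congruent to `m` and defined on
`T^x`, whence `T^x ≤ T` by maximality; so `x` normalizes `T`, and `IsMax.mem_sf_of_rel` applies. -/
theorem IsMax.conj_eq_of_conj_rho_eq {hL : 𝓛.IsLocality p Δ S} {m : L} (hm : hL.IsMax m)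
    {hp : p.Prime} {hΔ : hL.IsObjectiveAlmostCharP} {x s : L} (hxS : x ∈ S) (hs : s ∈ S)
    (hD : hL.rho hp hΔ x ∈ (hL.quotient hp hΔ).conjDom (hL.rho hp hΔ m))
    (hc : (hL.quotient hp hΔ).conj (hL.rho hp hΔ x) (hL.rho hp hΔ m) = hL.rho hp hΔ s) :
    x ∈ 𝓛.conjDom m ∧ 𝓛.conj x m = s := by
  have hπ := hL.isProjection_rho hp hΔ
  -- The word `(m⁻¹, x, m)` lies in the domain, since its entries have maximal domain.
  obtain ⟨R0, R1, R2, R3, h1, h2, h3⟩ : ∃ R0 R1 R2 R3, 𝓛.Arrow Δ R0 (𝓛.inv m) R1 ∧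
      𝓛.Arrow Δ R1 x R2 ∧ 𝓛.Arrow Δ R2 m R3 := by
    rw [conjDom, Set.mem_ofPred_eq, hπ.inv_map, hπ.dom] at hD
    obtain ⟨w, hw, hwe⟩ := hD
    obtain ⟨a, w, rfl, ha, hwe⟩ := List.map_eq_cons_iff.1 hwe
    obtain ⟨y, w, rfl, hy, hwe⟩ := List.map_eq_cons_iff.1 hwe
    obtain ⟨b, w, rfl, hb, hwe⟩ := List.map_eq_cons_iff.1 hwe
    obtain ⟨R0, _, R1, h1, R2, h2, R3, h3, -⟩ := hL.mem_D_iff_chain.1 hw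
    refine ⟨R0, R1, R2, R3, ?_, ?_, ?_⟩
    · exact ((hm.inv.rel_of_rho_eq ha).restrict hp hΔ h1.src (hL.subset_sf h1)).arrow h1
    · exact (((hL.isMax_of_mem hxS).rel_of_rho_eq hy).restrict hp hΔ h2.src
        (hL.subset_sf h2)).arrow h2
    · exact ((hm.rel_of_rho_eq hb).restrict hp hΔ h3.src (hL.subset_sf h3)).arrow h3
  have h1' : 𝓛.Arrow Δ R1 m R0 := by simpa [𝓛.inv_inv] using h1.inv
  have hxm := hL.mem_conjDom h2 h1' h3
  refine ⟨hxm, ?_⟩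
  have hcA := hL.arrow_conj h2 h1' h3
  rw [hπ.conj_map hxm] at hc
  have hr := (hL.isMax_of_mem hs).rel_of_rho_eq hc
  have hr0 := hr.restrict hp hΔ hcA.src (hL.subset_sf hcA)
  have hT := hL.sf_mem m
  have hmT := hL.arrow_of_subset_sf hT subset_rfl
  have hxT := hL.arrow_S hT hxS
  have hsT := hL.arrow_S hmT.tgt hs
  -- Over `R1`, the element `m s` is congruent to `m x^m = x m`.
  have hrel : hL.Rel R2 m (𝓛.mul (𝓛.inv x) (𝓛.mul m s)) := by
    have h4 := (hr0.mul_left h1').mul_left h2.inv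
    rwa [hL.mul_conj h2 h1' h3, hL.inv_mul_cancel_left h2 h3] at h4
  have hsub : 𝓛.conjSet (𝓛.sf S m) x ⊆ 𝓛.sf S m :=
    (hL.subset_sf (hxT.inv.comp hL (hmT.comp hL hsT))).trans
      (hm.rel_sf hp hΔ hrel).subset_right
  have hxN : x ∈ 𝓛.normalizer (𝓛.sf S m) :=
    hL.mem_normalizer_of_conj_mem fun y hy => ⟨hxT.sub hy, hsub ⟨y, hy, rfl⟩⟩
  have hxT' := (arrow_self_iff hT).2 hxN
  have hcT := hL.arrow_conj hxT' hmT hmT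
  have hx := hm.mem_sf_of_rel hp hxS hs hxN
    (hr.restrict hp hΔ hcT.src (hL.subset_sf hcT))
  exact hL.rho_injOn hp hΔ hx.2.2 hs hc

end IsLocality

end PartialGroup

/-! ### The quotient locality -/

namespace PartialGroup

variable {L : Type u} {𝓛 : PartialGroup L} {Δ : Set (Set L)} {S : Set L} {p : ℕ}

namespace IsLocality

/-- If the image in the quotient of an element `x` of `N_L(S)` has `p`-power order, then it lies in
the image of `S`: a suitable power of `x` has the same image and is a
`p`-element, hence lies in `S` by the maximality of `S`. -/
theorem rho_mem_of_pow_eq_one (hL : 𝓛.IsLocality p Δ S) (hp : p.Prime)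
    (hΔ : hL.IsObjectiveAlmostCharP) (x : hL.NormalizerGroup hL.S_mem) {k : ℕ}
    (hx : hL.rho hp hΔ (x ^ p ^ k).val = (hL.quotient hp hΔ).one) :
    hL.rho hp hΔ x.val ∈ hL.rho hp hΔ '' S := by
  have := hL.finite
  have hG := hL.isSubgroup_normalizer hL.S_mem
  have hπ := hL.isProjection_rho hp hΔ
  have hz : (orderOf (x ^ p ^ k)).Coprime p := by
    rw [hL.rho_eq_one_iff hp hΔ] at hx
    refine hL.orderOf_coprime_of_mem_theta (P := S) ?_
    rw [hL.theta_eq_Theta_inter hp hΔ hL.S_mem]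
    exact ⟨hx, (x ^ p ^ k).mem⟩
  -- `x ^ j` is congruent to `x` modulo `Θ(S)`, and its `p ^ k`-th power is trivial.
  obtain ⟨j, hj1, hj2⟩ := Nat.chineseRemainder (hz.symm.pow_left k) 1 0
  have hy : (x ^ j) ^ p ^ k = 1 := by
    rw [← pow_mul, mul_comm, pow_mul]
    exact orderOf_dvd_iff_pow_eq_one.1 ((Nat.modEq_zero_iff_dvd).1 hj2)
  let ψ := hπ.hom hG (hπ.isSubgroup_image hG) subset_rfl
  have hψ : ψ x ^ p ^ k = 1 := by
    rw [← map_pow]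
    exact IsSubgroup.Elems.ext hx
  have hψj : ψ (x ^ j) = ψ x := by
    rw [map_pow]
    conv_rhs => rw [← pow_one (ψ x)]
    exact pow_eq_pow_iff_modEq.2 (hj1.of_dvd (orderOf_dvd_of_pow_eq_one hψ))
  refine ⟨(x ^ j).val, ?_, congrArg IsSubgroup.Elems.val hψj⟩
  let A := hL.isSubgroup.restrict hG ⊔ Subgroup.zpowers (x ^ j)
  have hnorm : (hL.isSubgroup.restrict hG).Normal := by
    refine ⟨fun s hs g => ?_⟩
    have h1 := (g⁻¹).mem.2.subset (Set.mem_image_of_mem _ hs)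
    rw [← IsSubgroup.Elems.val_conj, _root_.inv_inv] at h1
    exact h1
  have hA : IsPGroup p A :=
    (hL.isPGroup_restrict_S hG).to_sup_of_normal_left (isPGroup_zpowers hy)
  have hAS := IsSubgroup.of_subgroup hG A
  have hmax := hL.maximal (IsSubgroup.Elems.val '' (A : Set hG.Elems)) ⟨hAS, inferInstance, ?_⟩ ?_
  · exact hmax.subset
      ⟨_, le_sup_right (a := hL.isSubgroup.restrict hG) (Subgroup.mem_zpowers _), rfl⟩
  · intro a
    obtain ⟨b, hb, hba⟩ := a.mem
    obtain ⟨n, hn⟩ := hA ⟨b, hb⟩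
    refine ⟨n, IsSubgroup.Elems.ext ?_⟩
    rw [← IsSubgroup.Elems.val_pow_congr hba, show b ^ p ^ n = 1 from congrArg Subtype.val hn]
    rfl
  · intro s hs
    exact ⟨hG.mk s (hL.subset_normalizer hL.S_mem hs),
      le_sup_left (a := hL.isSubgroup.restrict hG) hs, rfl⟩

section

variable {hL : 𝓛.IsLocality p Δ S} {hp : p.Prime} {hΔ : hL.IsObjectiveAlmostCharP}

/-- A subset of `S` is recovered from its image in the quotient. -/
theorem inter_preimage_image_rho {P : Set L} (hP : P ⊆ S) :
    S ∩ hL.rho hp hΔ ⁻¹' (hL.rho hp hΔ '' P) = P := by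
  ext x
  constructor
  · rintro ⟨hxS, y, hy, hxy⟩
    exact hL.rho_injOn hp hΔ (hP hy) hxS hxy ▸ hy
  · exact fun hx => ⟨hP hx, x, hx, rfl⟩

/-- Conjugation of subsets of `S` into `S` lifts from the quotient to elements with maximal
domain. -/
theorem IsMax.subset_sf_of_conjSet {m : L} (hm : hL.IsMax m) {P : Set L} (hP : P ⊆ S)
    (h1 : hL.rho hp hΔ '' P ⊆ (hL.quotient hp hΔ).conjDom (hL.rho hp hΔ m))
    (h2 : (hL.quotient hp hΔ).conjSet (hL.rho hp hΔ '' P) (hL.rho hp hΔ m) ⊆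
      hL.rho hp hΔ '' S) :
    P ⊆ 𝓛.sf S m ∧ (hL.quotient hp hΔ).conjSet (hL.rho hp hΔ '' P) (hL.rho hp hΔ m) =
      hL.rho hp hΔ '' 𝓛.conjSet P m := by
  have hsub : P ⊆ 𝓛.sf S m := by
    intro x hx
    obtain ⟨s, hs, hxs⟩ := h2 ⟨_, ⟨x, hx, rfl⟩, rfl⟩
    obtain ⟨h3, h4⟩ := hm.conj_eq_of_conj_rho_eq (hP hx) hs (h1 ⟨x, hx, rfl⟩) hxs.symm
    exact ⟨hP hx, h3, h4.symm ▸ hs⟩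
  exact ⟨hsub, ((hL.isProjection_rho hp hΔ).conjSet_map fun x hx => (hsub hx).2.1).2⟩

theorem isPSubgroup_image_rho :
    (hL.quotient hp hΔ).IsPSubgroup p (hL.rho hp hΔ '' S) := by
  have := hL.finite
  have hπ := hL.isProjection_rho hp hΔ
  have hS := hπ.isSubgroup_image hL.isSubgroup
  have hsurj : Function.Surjective (hπ.hom hL.isSubgroup hS subset_rfl) := by
    intro c
    obtain ⟨s, hs, hc⟩ := c.mem
    exact ⟨hL.isSubgroup.mk s hs, IsSubgroup.Elems.ext hc⟩
  exact ⟨hS, Finite.of_surjective _ hsurj, hL.isPSubgroup.2.2.of_surjective _ hsurj⟩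

/-- The image of `S` is a maximal `p`-subgroup of the quotient: an element normalizing it is
represented by an element of `N_L(S)`, to which `rho_mem_of_pow_eq_one` applies. -/
theorem eq_image_of_isPSubgroup {R : Set (𝓛.MaxRightCoset hL.Theta)}
    (hR : (hL.quotient hp hΔ).IsPSubgroup p R) (hSR : hL.rho hp hΔ '' S ⊆ R) :
    R = hL.rho hp hΔ '' S := by
  have := Fact.mk hp
  have := hL.finite
  have hπ := hL.isProjection_rho hp hΔ
  have hS := hπ.isSubgroup_image hL.isSubgroup
  obtain ⟨hRs, _, hRp⟩ := hR
  have := hRp.isNilpotent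
  refine Set.Subset.antisymm (fun r hr => ?_) hSR
  by_contra hrS
  have hlt : hS.restrict hRs < ⊤ := by
    rw [lt_top_iff_ne_top]
    intro h
    have : hRs.mk r hr ∈ hS.restrict hRs := h ▸ Subgroup.mem_top _
    exact hrS this
  obtain ⟨n, hn, hnS⟩ := SetLike.exists_of_lt (Group.normalizerCondition_of_isNilpotent _ hlt)
  apply hnS
  rw [IsSubgroup.mem_restrict, ← hL.rho_sigma hp hΔ n.val]
  have hm := hL.isMax_sigma hp hΔ n.val
  have hρm := hL.rho_sigma hp hΔ n.val
  set m := hL.sigma hp hΔ n.val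
  have hSm := (hm.subset_sf_of_conjSet (hp := hp) (hΔ := hΔ) (subset_refl S) (by
    rw [hρm]
    exact fun c hc => hRs.mem_conjDom (hSR hc) n.mem) (by
    rw [hρm]
    rintro _ ⟨c, hc, rfl⟩
    have h := (Subgroup.mem_normalizer_iff''.1 hn (hRs.mk c (hSR hc))).1 hc
    rwa [IsSubgroup.mem_restrict, IsSubgroup.Elems.val_conj] at h)).1
  have hmN : m ∈ 𝓛.normalizer S :=
    hL.mem_normalizer_of_conj_mem fun y hy => (hSm hy).2
  obtain ⟨k, hk⟩ := hRp n
  have hG := hL.isSubgroup_normalizer hL.S_mem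
  refine hL.rho_mem_of_pow_eq_one hp hΔ (hG.mk m hmN) (k := k) ?_
  let ψ := hπ.hom hG (hπ.isSubgroup_image hG) subset_rfl
  change (ψ (hG.mk m hmN ^ p ^ k)).val = _
  rw [map_pow, IsSubgroup.Elems.val_pow_congr (x := ψ (hG.mk m hmN)) (y := n) hρm, hk]
  rfl

/-- The quotient is a locality. Chains of objects and conjugates of objects lift to `L` by
`IsMax.subset_sf_of_conjSet`, if elements of the quotient are represented by elements with maximal
domain. -/
theorem isLocality_quotient :
    (hL.quotient hp hΔ).IsLocality p ((fun P => hL.rho hp hΔ '' P) '' Δ) (hL.rho hp hΔ '' S) where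
  finite := by
    have := hL.finite
    unfold MaxRightCoset
    infer_instance
  isPSubgroup := isPSubgroup_image_rho
  nonempty := hL.nonempty.image _
  subgroup_of_mem := by
    rintro _ ⟨P, hP, rfl⟩
    exact ⟨(hL.isProjection_rho hp hΔ).isSubgroup_image (hL.isSubgroup_of_mem hP),
      Set.image_mono (hL.subset_S hP)⟩
  maximal R hR hSR := eq_image_of_isPSubgroup hR hSR
  mem_D_iff v := by
    constructor
    · rintro ⟨w, hw, rfl⟩
      obtain ⟨F, h1, h2⟩ := (hL.mem_D_iff w).1 hw
      refine ⟨fun i => hL.rho hp hΔ '' F i, ?_, ?_⟩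
      · intro i hi
        exact ⟨_, h1 i (by simpa using hi), rfl⟩
      · intro i hi
        have hi' : i < w.length := by simpa using hi
        have h := (hL.isProjection_rho hp hΔ).conjSet_map (h2 i hi').1
        rw [(h2 i hi').2] at h
        simpa using h
    · rintro ⟨F, h1, h2⟩
      have hv : v = (v.map (hL.sigma hp hΔ)).map (hL.rho hp hΔ) := by
        simp [Function.comp_def, hL.rho_sigma hp hΔ]
      rw [hv]
      refine (hL.isProjection_rho hp hΔ).map_mem ?_
      have hF : ∀ i ≤ v.length, ∃ P ∈ Δ, F i = hL.rho hp hΔ '' P ∧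
          S ∩ hL.rho hp hΔ ⁻¹' (F i) = P := by
        intro i hi
        obtain ⟨P, hP, hPF⟩ := h1 i hi
        exact ⟨P, hP, hPF.symm, hPF ▸ inter_preimage_image_rho (hL.subset_S hP)⟩
      rw [hL.mem_D_iff]
      refine ⟨fun i => S ∩ hL.rho hp hΔ ⁻¹' (F i), ?_, ?_⟩
      · intro i hi
        obtain ⟨P, hP, -, hPi⟩ := hF i (by simpa using hi)
        have h : S ∩ hL.rho hp hΔ ⁻¹' F i ∈ Δ := hPi.symm ▸ hP
        exact h
      · intro i hi
        have hi' : i < v.length := by simpa using hi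
        obtain ⟨P, hP, hPF, hPi⟩ := hF i hi'.le
        obtain ⟨Q, hQ, hQF, hQi⟩ := hF (i + 1) hi'
        obtain ⟨h3, h4⟩ := h2 i hi'
        rw [List.getElem_map]
        dsimp only
        rw [hPi, hQi]
        rw [hPF, ← hL.rho_sigma hp hΔ v[i]] at h3 h4
        have h5 := (hL.isMax_sigma hp hΔ v[i]).subset_sf_of_conjSet (hL.subset_S hP) h3 (by
          rw [h4, hQF]
          exact Set.image_mono (hL.subset_S hQ))
        have h6 := hL.arrow_of_subset_sf hP h5.1
        refine ⟨h6.sub, ?_⟩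
        rw [h5.2, hQF] at h4
        rw [← inter_preimage_image_rho (hp := hp) (hΔ := hΔ) (hL.subset_S h6.tgt), h4,
          inter_preimage_image_rho (hL.subset_S hQ)]
  conj_mem := by
    rintro _ ⟨P, hP, rfl⟩ g h1 h2
    rw [← hL.rho_sigma hp hΔ g] at h1 h2 ⊢
    have h3 := (hL.isMax_sigma hp hΔ g).subset_sf_of_conjSet (hL.subset_S hP) h1 h2
    exact ⟨_, (hL.arrow_of_subset_sf hP h3.1).tgt, h3.2.symm⟩
  over_mem := by
    rintro _ ⟨P, hP, rfl⟩ Q hQ hQS hPQ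
    have hπ := hL.isProjection_rho hp hΔ
    have hS := hL.isSubgroup
    refine ⟨S ∩ hL.rho hp hΔ ⁻¹' Q, hL.over_mem P hP _ (hS.of_subset Set.inter_subset_left
      ?_ ?_ ?_) Set.inter_subset_left ?_, ?_⟩
    · refine ⟨hS.one_mem, ?_⟩
      rw [Set.mem_preimage, hπ.one_map]
      exact hQ.one_mem
    · intro x hx
      refine ⟨hS.inv_mem hx.1, ?_⟩
      rw [Set.mem_preimage, ← hπ.inv_map]
      exact hQ.inv_mem hx.2
    · intro x hx y hy
      refine ⟨hS.mul_mem hx.1 hy.1, ?_⟩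
      rw [Set.mem_preimage, mul, ← hπ.prod_map _ (hS.2 _ (by simp [hx.1, hy.1]))]
      exact hQ.mul_mem hx.2 hy.2
    · exact fun x hx => ⟨hL.subset_S hP hx, hPQ ⟨x, hx, rfl⟩⟩
    · refine Set.Subset.antisymm ?_ ?_
      · rintro _ ⟨x, hx, rfl⟩
        exact hx.2
      · intro c hc
        obtain ⟨x, hx, rfl⟩ := hQS hc
        exact ⟨x, ⟨hx, hc⟩, rfl⟩

/-! ### Normalizers of objects in the quotient -/

/-- The normalizer of an object in the quotient is the image of its normalizer in `L`. -/
theorem image_normalizer {P : Set L} (hP : P ∈ Δ) :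
    hL.rho hp hΔ '' 𝓛.normalizer P = (hL.quotient hp hΔ).normalizer (hL.rho hp hΔ '' P) := by
  refine ((hL.isProjection_rho hp hΔ).image_normalizer_subset P).antisymm ?_
  intro g hg
  refine ⟨hL.sigma hp hΔ g, ?_, hL.rho_sigma hp hΔ g⟩
  obtain ⟨h1, h2⟩ := hg
  rw [← hL.rho_sigma hp hΔ g] at h1 h2
  have h3 := (hL.isMax_sigma hp hΔ g).subset_sf_of_conjSet (hL.subset_S hP) h1
    (h2.subset.trans (Set.image_mono (hL.subset_S hP)))
  have h4 := hL.arrow_of_subset_sf hP h3.1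
  refine ⟨h4.sub, ?_⟩
  rw [← inter_preimage_image_rho (hp := hp) (hΔ := hΔ) (hL.subset_S h4.tgt), ← h3.2, h2,
    inter_preimage_image_rho (hL.subset_S hP)]

theorem exists_normalizer_hom
    (hQ : (hL.quotient hp hΔ).IsLocality p ((fun P => hL.rho hp hΔ '' P) '' Δ)
      (hL.rho hp hΔ '' S)) {P : Set L} (hP : P ∈ Δ) :
    ∃ φ : hL.NormalizerGroup hP →* hQ.NormalizerGroup (Set.mem_image_of_mem _ hP),
      (∀ x, (φ x).val = hL.rho hp hΔ x.val) ∧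
      φ.ker = OpPrime p (hL.NormalizerGroup hP) ∧
      ∃ ē : hL.NormalizerGroup hP ⧸ OpPrime p (hL.NormalizerGroup hP) ≃*
          hQ.NormalizerGroup (Set.mem_image_of_mem _ hP),
        ∀ x : hL.NormalizerGroup hP, ē (QuotientGroup.mk x) = φ x := by
  let φ : hL.NormalizerGroup hP →* hQ.NormalizerGroup (Set.mem_image_of_mem _ hP) :=
    (hL.isProjection_rho hp hΔ).hom (hL.isSubgroup_normalizer hP)
      (hQ.isSubgroup_normalizer (Set.mem_image_of_mem _ hP)) (image_normalizer hP).subset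
  have hval : ∀ x, (φ x).val = hL.rho hp hΔ x.val := fun _ => rfl
  have hker : φ.ker = OpPrime p (hL.NormalizerGroup hP) := by
    ext x
    rw [MonoidHom.mem_ker, ← hL.mem_theta hP, hL.theta_eq_Theta_inter hp hΔ hP]
    constructor
    · intro h
      refine ⟨(hL.rho_eq_one_iff hp hΔ).1 ?_, x.mem⟩
      rw [← hval, h]
      rfl
    · intro h
      exact IsSubgroup.Elems.ext ((hL.rho_eq_one_iff hp hΔ).2 h.1)
  have hsurj : Function.Surjective φ := by
    intro y
    obtain ⟨x, hx, hxy⟩ := (image_normalizer hP).superset y.mem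
    exact ⟨(hL.isSubgroup_normalizer hP).mk x hx, IsSubgroup.Elems.ext hxy⟩
  exact ⟨φ, hval, hker, (QuotientGroup.quotientMulEquivOfEq hker.symm).trans
    (QuotientGroup.quotientKerEquivOfSurjective φ hsurj), fun x => rfl⟩

end

end IsLocality

end PartialGroup

/-! ### Transport of fusion systems -/

namespace FusionSystem

variable {S : Type u} [Group S] {S' : Type v} [Group S']

/-- The homomorphism `P^e → Q^e` corresponding to `φ : P → Q` under the isomorphism `e`. -/
def transport (e : S ≃* S') {P Q : Subgroup S} (φ : P →* Q) :
    P.map e.toMonoidHom →* Q.map e.toMonoidHom :=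
  (e.subgroupMap Q).toMonoidHom.comp (φ.comp (e.subgroupMap P).symm.toMonoidHom)

theorem transport_subgroupMap (e : S ≃* S') {P Q : Subgroup S} (φ : P →* Q) (x : P) :
    transport e φ (e.subgroupMap P x) = e.subgroupMap Q (φ x) := by
  change e.subgroupMap Q (φ ((e.subgroupMap P).symm (e.subgroupMap P x))) = _
  rw [MulEquiv.symm_apply_apply]

theorem transport_apply (e : S ≃* S') {P Q : Subgroup S} (φ : P →* Q) (x : P)
    (hx : e x ∈ P.map e.toMonoidHom) : (transport e φ ⟨e x, hx⟩ : S') = e (φ x) :=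
  congrArg Subtype.val (transport_subgroupMap e φ x)

/-- The fusion system over `S` corresponding to the fusion system `F` over `S'` under an
isomorphism `S ≃ S'`. -/
def comap (e : S ≃* S') (F : FusionSystem S') : FusionSystem S where
  Hom P Q := {φ | transport e φ ∈ F.Hom _ _}
  injective {P Q φ} h x y hxy := by
    have := F.injective h (a₁ := e.subgroupMap P x) (a₂ := e.subgroupMap P y)
      (by rw [transport_subgroupMap, transport_subgroupMap, hxy])
    exact (e.subgroupMap P).injective this
  conj_mem {P Q} s φ h := by
    refine F.conj_mem (e s) _ ?_
    rintro ⟨_, x, hx, rfl⟩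
    have h1 := transport_apply e φ ⟨x, hx⟩ ⟨x, hx, rfl⟩
    refine h1.trans ?_
    rw [h]
    simp
  comp_mem {P Q R φ ψ} h h' := by
    have he : transport e (ψ.comp φ) = (transport e ψ).comp (transport e φ) := by
      refine MonoidHom.ext fun y => ?_
      obtain ⟨x, rfl⟩ := (e.subgroupMap P).surjective y
      exact (transport_subgroupMap e (ψ.comp φ) x).trans
        ((congrArg (transport e ψ) (transport_subgroupMap e φ x)).trans
          (transport_subgroupMap e ψ (φ x))).symm
    rw [Set.mem_ofPred_eq, he]
    exact F.comp_mem h h'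
  factor {P Q φ} h R ε hε := by
    let ε' := ((e.subgroupMap P).symm.trans ε).trans (e.subgroupMap R)
    refine F.factor h _ ε' ?_
    rintro ⟨_, x, hx, rfl⟩
    have h1 := transport_apply e φ ⟨x, hx⟩ ⟨x, hx, rfl⟩
    have h2 := transport_apply e ε.toMonoidHom ⟨x, hx⟩ ⟨x, hx, rfl⟩
    refine h2.trans (Eq.trans ?_ h1.symm)
    exact congrArg e (hε ⟨x, hx⟩)

/-- Membership in a fusion system depends only on the values of a homomorphism. -/
theorem mem_hom_of_eq (F : FusionSystem S) {P P' Q Q' : Subgroup S} (hP : P = P') (hQ : Q = Q')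
    {φ : P →* Q} {φ' : P' →* Q'} (h : ∀ (x : S) (hx : x ∈ P) (hx' : x ∈ P'),
      (φ ⟨x, hx⟩ : S) = φ' ⟨x, hx'⟩) (hφ : φ' ∈ F.Hom P' Q') : φ ∈ F.Hom P Q := by
  subst hP hQ
  have : φ = φ' := by
    ext x
    exact h x x.2 x.2
  rwa [this]

/-- If the isomorphism `e` transports two families of fusion systems into each other, it induces
an isomorphism between their intersections. -/
theorem inducesIso_sInf (e : S ≃* S') {A : Set (FusionSystem S)} {B : Set (FusionSystem S')}
    (hBA : ∀ F ∈ B, comap e F ∈ A) (hAB : ∀ F ∈ A, comap e.symm F ∈ B) :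
    (sInf A).InducesIso (sInf B) e.toMonoidHom := by
  refine ⟨⟨?_, e.surjective, ?_⟩, e.injective⟩
  · intro P Q φ hφ
    refine ⟨transport e φ, ⟨?_, fun F hF => hφ.2 _ (hBA F hF)⟩, ?_⟩
    · exact (e.subgroupMap Q).injective.comp (hφ.1.comp (e.subgroupMap P).symm.injective)
    · exact fun x => transport_apply e φ x _
  · intro P Q _ ψ hψ
    let φ : P →* Q :=
      (e.subgroupMap Q).symm.toMonoidHom.comp (ψ.comp (e.subgroupMap P).toMonoidHom)
    have hφ : ∀ x : P, (ψ ⟨e.toMonoidHom x, Subgroup.mem_map_of_mem _ x.2⟩ : S') = e (φ x) := by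
      intro x
      have : e.subgroupMap Q (φ x) = ψ (e.subgroupMap P x) := MulEquiv.apply_symm_apply _ _
      exact (congrArg Subtype.val this).symm
    refine ⟨φ, ⟨?_, fun F hF => ?_⟩, hφ⟩
    · exact (e.subgroupMap Q).symm.injective.comp (hψ.1.comp (e.subgroupMap P).injective)
    · have h := hψ.2 _ (hAB F hF)
      have hmap : ∀ R : Subgroup S, R = (R.map e.toMonoidHom).map e.symm.toMonoidHom := by
        intro R
        rw [Subgroup.map_map]
        ext x
        simp
      refine F.mem_hom_of_eq (hmap P) (hmap Q) (fun x hx hx' => ?_) h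
      have h1 := transport_apply e.symm ψ ⟨e x, Subgroup.mem_map_of_mem _ hx⟩
        (by simpa using hx')
      simp only [MulEquiv.symm_apply_apply] at h1
      rw [h1, MulEquiv.eq_symm_apply]
      exact (hφ ⟨x, hx⟩).symm

end FusionSystem

namespace PartialGroup

variable {L : Type u} {𝓛 : PartialGroup L} {Δ : Set (Set L)} {S : Set L} {p : ℕ}

namespace IsLocality

/-- Every conjugation map between subgroups of the image of `S` is induced by an element of `L`
with maximal domain, and so comes from a conjugation map in `L`. -/
theorem exists_inducesIso {hL : 𝓛.IsLocality p Δ S} {hp : p.Prime}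
    {hΔ : hL.IsObjectiveAlmostCharP}
    (hQ : (hL.quotient hp hΔ).IsLocality p ((fun P => hL.rho hp hΔ '' P) '' Δ)
      (hL.rho hp hΔ '' S)) :
    ∃ e : hL.isSubgroup.Elems ≃* hQ.isSubgroup.Elems,
      (∀ s, (e s).val = hL.rho hp hΔ s.val) ∧
      hL.fusionSystem.InducesIso hQ.fusionSystem e.toMonoidHom := by
  have hπ := hL.isProjection_rho hp hΔ
  let e : hL.isSubgroup.Elems ≃* hQ.isSubgroup.Elems :=
    MulEquiv.ofBijective (hπ.hom hL.isSubgroup hQ.isSubgroup subset_rfl) ⟨fun x y hxy =>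
      IsSubgroup.Elems.ext (hL.rho_injOn hp hΔ x.mem y.mem (congrArg IsSubgroup.Elems.val hxy)),
      fun c => by
        obtain ⟨s, hs, hc⟩ := c.mem
        exact ⟨hL.isSubgroup.mk s hs, IsSubgroup.Elems.ext hc⟩⟩
  have he : ∀ s, (e s).val = hL.rho hp hΔ s.val := fun _ => rfl
  refine ⟨e, he, FusionSystem.inducesIso_sInf e ?_ ?_⟩
  · intro F hF P Q φ g hφ
    refine hF _ _ _ (hL.rho hp hΔ g) ?_
    rintro ⟨_, x, hx, rfl⟩
    obtain ⟨h1, h2⟩ := hφ ⟨x, hx⟩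
    refine ⟨hπ.mem_conjDom h1, ?_⟩
    have h3 := FusionSystem.transport_apply e φ ⟨x, hx⟩ ⟨x, hx, rfl⟩
    refine (congrArg IsSubgroup.Elems.val h3).trans ?_
    rw [he, h2]
    exact (hπ.conj_map h1).symm
  · intro F hF P Q ψ g hψ
    refine hF _ _ _ (hL.sigma hp hΔ g) ?_
    rintro ⟨_, y, hy, rfl⟩
    obtain ⟨h1, h2⟩ := hψ ⟨y, hy⟩
    have h3 := FusionSystem.transport_apply e.symm ψ ⟨y, hy⟩ ⟨y, hy, rfl⟩
    have hyx : (e (e.symm y)).val = y.val := by rw [e.apply_symm_apply]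
    have hsz : (e (e.symm (ψ ⟨y, hy⟩))).val = (ψ ⟨y, hy⟩).1.val := by rw [e.apply_symm_apply]
    rw [he] at hyx hsz
    have h4 := (hL.isMax_sigma hp hΔ g).conj_eq_of_conj_rho_eq (hp := hp) (hΔ := hΔ)
      (e.symm y).mem (e.symm (ψ ⟨y, hy⟩)).mem (by rw [hyx, hL.rho_sigma hp hΔ]; exact h1)
      (by rw [hyx, hL.rho_sigma hp hΔ, hsz]; exact h2.symm)
    exact ⟨h4.1, (congrArg IsSubgroup.Elems.val h3).trans h4.2.symm⟩

end IsLocality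

end PartialGroup

theorem mainTheorem8 {L : Type u} (p : ℕ) (hp : p.Prime) (𝓛 : PartialGroup L)
    (Δ : Set (Set L)) (S : Set L) (hL : 𝓛.IsLocality p Δ S)
    (hΔ : ∀ (P : Set L) (hP : P ∈ Δ), IsAlmostCharP p (hL.NormalizerGroup hP)) :
    𝓛.IsPartialNormal hL.Theta ∧ hL.Theta ∩ S = {𝓛.one} ∧
    ∃ (𝓠 : PartialGroup (𝓛.MaxRightCoset hL.Theta)) (ρ : L → 𝓛.MaxRightCoset hL.Theta),
      𝓛.IsQuotient hL.Theta 𝓠 ρ ∧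
      ∃ hQ : 𝓠.IsLocality p ((fun P => ρ '' P) '' Δ) (ρ '' S),
        hQ.IsObjectiveCharP ∧
        (∃ e : hL.isSubgroup.Elems ≃* hQ.isSubgroup.Elems,
          (∀ s, (e s).val = ρ s.val) ∧
          hL.fusionSystem.InducesIso hQ.fusionSystem e.toMonoidHom) ∧
        ∀ (P : Set L) (hP : P ∈ Δ),
          ∃ φ : hL.NormalizerGroup hP →* hQ.NormalizerGroup (Set.mem_image_of_mem _ hP),
            (∀ x, (φ x).val = ρ x.val) ∧
            φ.ker = OpPrime p (hL.NormalizerGroup hP) ∧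
            ∃ ē : hL.NormalizerGroup hP ⧸ OpPrime p (hL.NormalizerGroup hP) ≃*
                hQ.NormalizerGroup (Set.mem_image_of_mem _ hP),
              ∀ x : hL.NormalizerGroup hP, ē (QuotientGroup.mk x) = φ x := by
  refine ⟨hL.isPartialNormal_Theta hp hΔ, hL.Theta_inter_S, hL.quotient hp hΔ, hL.rho hp hΔ,
    hL.isQuotient hp hΔ, PartialGroup.IsLocality.isLocality_quotient, ?_,
    PartialGroup.IsLocality.exists_inducesIso _,
    fun P hP => PartialGroup.IsLocality.exists_normalizer_hom _ hP⟩
  rintro _ ⟨P, hP, rfl⟩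
  obtain ⟨_, -, -, e, -⟩ := PartialGroup.IsLocality.exists_normalizer_hom
    (PartialGroup.IsLocality.isLocality_quotient (hp := hp) (hΔ := hΔ)) hP
  exact (hΔ P hP).of_mulEquiv e
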